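/- Let $K$ be a local field, i.e. the fraction field of a complete discrete valuation ring $\mathcal O$ with maximal ideal $\mathfrak p$ and finite residue field of $q$ elements, let $v_K$ be its normalized valuation, and fix an algebraic closure $\overline K$. Let $x\in K^\times$ with $v_K(x)=n>0$, and let $L=K_n:=K(\boldsymbol\mu_{q^n-1})\subset\overline K$ be the unramified extension of degree $n$, with ring of integers $\mathcal O_L$ and arithmetic Frobenius $\varphi\in\operatorname{Gal}(L/K)$ (reducing to $a\mapsto a^q$ modulo $\mathfrak p$). Let $\pi$ be a uniformizer of $L$ with $N_{L/K}(\pi)=x$, and let $f\in\mathcal O_L[X]$ be a monic polynomial with $f(X)\equiv \pi X \pmod{X^2}$ and $f(X)\equiv X^q\pmod{\mathfrak p\mathcal O_L}$. For $m\ge 1$ put $f_m:=f^{\varphi^{m-1}}\circ\cdots\circ f^{\varphi}\circ f$, where $f^{\varphi^i}$ is obtained by applying $\varphi^i$ to the coefficients of $f$, and let $K_x^m$ be the splitting field of $f_m$ over $L$ in $\overline K$. For a finite totally ramified Galois extension $E/L$ with group $G$, a uniformizer $\varpi$ of $E$ and $\sigma\in G$, put $i(\sigma):=v_E(\sigma(\varpi)-\varpi)$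 (with $i(\mathrm{id})=\infty$), and for real $t\ge 0$ put $$G_t:=\{\sigma\in G\mid i(\sigma)\ge t+1\},\qquad \phi_G(t):=-1+\frac1{|G|}\sum_{\tau\in G}\min\{i(\tau),t+1\},$$ and $G^s:=G_{\phi_G^{-1}(s)}$ for real $s\ge 0$ (the upper numbering; these do not depend on $\varpi$). Then for all $m\ge1$ the extension $K_x^m/L$ is finite, totally ramified and Galois (so that the upper numbering of its Galois group is defined), and $$\operatorname{Gal}(K_x^m/L)^m=\{\mathrm{id}\}.$$ -/

import Mathlib

open Polynomial IsLocalRing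
open scoped NNReal ENNReal

namespace LubinTate

/-- An intermediate field `L` of `Ω / K` is compatible with the algebra structures over `O`. -/
instance isScalarTower_intermediateField {O K Ω : Type*} [CommRing O] [Field K] [Field Ω]
    [Algebra O K] [Algebra K Ω] [Algebra O Ω] [IsScalarTower O K Ω] (L : IntermediateField K Ω) :
    IsScalarTower O L Ω :=
  IsScalarTower.subalgebra' O Ω Ω (L.toSubalgebra.restrictScalars O)

/-! ### Extensions of a complete discrete valuation field

`O` is a discrete valuation ring and `E` is a field that is an `O`-algebra. -/

section Ramification

variable (O : Type*) [CommRing O]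

/-- The ring of integers of `E`: the integral closure of `O` in `E`. -/
abbrev integers (E : Type*) [Field E] [Algebra O E] : Subalgebra O E := integralClosure O E

variable {O} in
/-- A uniformizer of `E`. When the ring of integers is a discrete valuation ring, its irreducible
elements are exactly the generators of its maximal ideal. -/
def IsUniformizer {E : Type*} [Field E] [Algebra O E] (ϖ : integers O E) : Prop :=
  Irreducible ϖ

variable (F E : Type*) [Field F] [Field E] [Algebra O F] [Algebra O E] [Algebra F E]
  [IsScalarTower O F E]

/-- `E / F` is a finite totally ramified Galois extension: the ring of integers of `E` is a discrete
valuation ring, and the residue field extension has degree `1`, that is, every integer of `E` is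
congruent to an integer of `F` modulo the maximal ideal (the set of non-units). -/
structure IsTotallyRamifiedGalois : Prop where
  finiteDimensional : FiniteDimensional F E
  isGalois : IsGalois F E
  isDiscreteValuationRing : IsDiscreteValuationRing (integers O E)
  residue : ∀ a : integers O E, ∃ b : integers O F,
    ¬ IsUnit (a - (IsScalarTower.toAlgHom O F E).mapIntegralClosure b)

variable {O F E}

/-- `i(σ) = v_E (σ ϖ - ϖ)` for a uniformizer `ϖ` of `E`; it is `⊤` for `σ = 1`. The normalized
valuation of an integer `a` of `E` is the largest `k` such that `ϖ ^ k` divides `a`. -/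
noncomputable def ramIndex (ϖ : integers O E) (σ : E ≃ₐ[F] E) : ℕ∞ :=
  emultiplicity ϖ ((σ.restrictScalars O).mapIntegralClosure ϖ - ϖ)

variable (F) in
/-- The lower numbering `G_t = {σ ∈ G | i(σ) ≥ t + 1}` for real `t ≥ 0`, where `G = Gal(E/F)`. -/
def lowerRamificationGroup (ϖ : integers O E) (t : ℝ≥0) : Set (E ≃ₐ[F] E) :=
  {σ | ((t + 1 : ℝ≥0) : ℝ≥0∞) ≤ ((ramIndex ϖ σ : ℕ∞) : ℝ≥0∞)}

variable (F) in
/-- The Herbrand function `φ_G(t) = -1 + |G|⁻¹ ∑_{τ ∈ G} min {i(τ), t + 1}` for real `t ≥ 0`. -/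
noncomputable def herbrand [FiniteDimensional F E] (ϖ : integers O E) (t : ℝ≥0) : ℝ :=
  -1 + (∑ τ : E ≃ₐ[F] E,
    (min ((ramIndex ϖ τ : ℕ∞) : ℝ≥0∞) ((t + 1 : ℝ≥0) : ℝ≥0∞)).toReal) / Nat.card (E ≃ₐ[F] E)

variable (F) in
/-- The upper numbering `G^s = G_t` with `t = φ_G⁻¹(s)`, for real `s ≥ 0`. (When `E / F` is
totally ramified Galois and `ϖ` is a uniformizer, `φ_G` is a strictly increasing bijection of `[0, ∞)`
onto itself, so exactly one `t` occurs.) -/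
def upperRamificationGroup [FiniteDimensional F E] (ϖ : integers O E) (s : ℝ≥0) :
    Set (E ≃ₐ[F] E) :=
  {σ | ∃ t : ℝ≥0, herbrand F ϖ t = s ∧ σ ∈ lowerRamificationGroup F ϖ t}

end Ramification

/-! ### Relative Lubin–Tate extensions

`O` is a complete discrete valuation ring with finite residue field, `K` its fraction field, and `Ω`
an algebraic closure of `K`. -/

section Extension

variable (O : Type*) [CommRing O] [IsDomain O] [IsDiscreteValuationRing O]

/-- The number `q` of elements of the residue field. -/
noncomputable abbrev residueCard : ℕ := Nat.card (ResidueField O)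

/-- `v_K(x) = n` for the normalized valuation `v_K` of the fraction field `K` of `O`. -/
def HasValuation {K : Type*} [Field K] [Algebra O K] [IsFractionRing O K] (x : K) (n : ℤ) : Prop :=
  (IsDiscreteValuationRing.maximalIdeal O).valuation K x = WithZero.exp (-n)

/-- The unramified extension `K_n = K(μ_{q^n - 1})` inside `Ω`. -/
noncomputable def unramifiedExt (K Ω : Type*) [Field K] [Field Ω] [Algebra K Ω] (n : ℕ) :
    IntermediateField K Ω :=
  IntermediateField.adjoin K {z : Ω | z ^ (residueCard O ^ n - 1) = 1}

variable {O} {K L : Type*} [Field K] [Field L] [Algebra O K] [Algebra O L] [Algebra K L]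
  [IsScalarTower O K L]

/-- The action on the ring of integers of `L` of an automorphism of `L / K`. -/
noncomputable def onIntegers (φ : L ≃ₐ[K] L) : integers O L ≃ₐ[O] integers O L :=
  (φ.restrictScalars O).mapIntegralClosure

variable (O) in
/-- `φ` is the arithmetic Frobenius of the unramified extension `L / K`: it reduces modulo the
maximal ideal `𝔭` of `O` to the `q`-th power map. -/
def IsArithFrobenius (φ : L ≃ₐ[K] L) : Prop :=
  ∀ a : integers O L, onIntegers φ a - a ^ residueCard O ∈
    (maximalIdeal O).map (algebraMap O (integers O L))

/-- `f` is monic, `f ≡ π X` modulo degree `2`, and `f ≡ X ^ q` modulo `𝔭`. -/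
structure IsLubinTatePolynomial (π : integers O L) (f : (integers O L)[X]) : Prop where
  monic : f.Monic
  coeff_zero : f.coeff 0 = 0
  coeff_one : f.coeff 1 = π
  congr_pow : ∀ i, (f - X ^ residueCard O).coeff i ∈
    (maximalIdeal O).map (algebraMap O (integers O L))

/-- `f_m = f^{φ^{m-1}} ∘ ⋯ ∘ f^φ ∘ f`, with `f_0 = X`. -/
noncomputable def iterate (φ : L ≃ₐ[K] L) (f : (integers O L)[X]) : ℕ → (integers O L)[X]
  | 0 => X
  | m + 1 => (f.map (onIntegers (O := O) (φ ^ m) : integers O L →+* integers O L)).comp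
      (iterate φ f m)

/-- The field `L_f^m`: the splitting field of `f_m` over `L`, inside `Ω`. -/
noncomputable def lubinTateExt (Ω : Type*) [Field Ω] [Algebra L Ω] (φ : L ≃ₐ[K] L)
    (f : (integers O L)[X]) (m : ℕ) : IntermediateField L Ω :=
  IntermediateField.adjoin L
    (((iterate φ f m).map (algebraMap (integers O L) L)).rootSet Ω)

instance (Ω : Type*) [Field Ω] [Algebra L Ω] [Algebra.IsAlgebraic L Ω] (φ : L ≃ₐ[K] L)
    (f : (integers O L)[X]) (m : ℕ) : FiniteDimensional L (lubinTateExt Ω φ f m) :=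
  have : Finite (((iterate φ f m).map (algebraMap (integers O L) L)).rootSet Ω) :=
    Polynomial.rootSet_finite _ _
  IntermediateField.finiteDimensional_adjoin fun x _ ↦ Algebra.IsIntegral.isIntegral x

end Extension

end LubinTate

/-! Write A for the ring of integers of L, s for the Frobenius on A, ω for a uniformizer of O (it
remains one in A), m + 1 for the level, and g = f_{m+1} / f_m, called `primPoly`. Then g is
Eisenstein of degree q^m (q - 1). Let α be a root of g.

All roots of f_{m+1} lie in L(α). Each a in O is the linear coefficient of a power series [a] with f
∘ [a] = [a]^s ∘ f (`exists_powerSeries_comm`), and [a](α) is again a root of f_{m+1}. These values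
are distinct for a incongruent modulo ω^(m+1): the series D = [a] - [b] divides D^s ∘ f, so if g
divides D then all of f_{m+1} does (`levelPoly_dvd_of_primPoly_dvd`), and ω^(m+1) divides the linear
coefficient of f_{m+1}. This produces q^(m+1) = deg f_{m+1} roots. Evaluation at α needs no
convergence: Weierstrass division gives A[[X]]/(g) ≅ A[X]/(g) (`exists_eval`). Hence the splitting
field is L(α), Galois of degree deg g, totally ramified, with integers A[α] and uniformizer α.

For the upper numbering, a bound on i and the sum of its values suffice. Here v(ω) = q^m (q - 1). If
v(y - x) > q^m, the linear term of every twist of f dominates, so f_{m+1}(y) - f_{m+1}(x) is (y - x)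
ω^(m+1) up to a unit; distinct roots are therefore never that close to α, and i(τ) ≤ q^m for τ ≠ 1
(`emultiplicity_sub_le`). The sum of these i(τ) is v(g'(α)), and f_{m+1}'(α) = f_m(α) g'(α) shows
that it equals (m + 1) q^m (q - 1) - q^m (`emultiplicity_derivative`). At t + 1 = q^(m+1) the
identity contributes q^(m+1) to the Herbrand sum, the total is (m + 2) q^m (q - 1), and so φ_G(t) =
m + 1. As q^m < q^(m+1), only the identity lies in G_t. -/

namespace LubinTate

/-! ### Affine equations in complete rings -/

section FixedPoint

/-- An affine equation `b = r * s b + y` with `r ∈ I` is solvable in an `I`-adically complete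
ring. -/
theorem exists_eq_mul_map_add {A : Type*} [CommRing A] (I : Ideal A) [IsAdicComplete I A]
    (s : A →+* A) (hs : ∀ a ∈ I, s a ∈ I) {r : A} (hr : r ∈ I) (y : A) :
    ∃ b, b = r * s b + y := by
  have hs' : ∀ n, ∀ a ∈ I ^ n, s a ∈ I ^ n := by
    intro n a ha
    have h1 : I.map s ≤ I := Ideal.map_le_iff_le_comap.2 hs
    have h2 : (I ^ n).map s ≤ I ^ n := by
      rw [Ideal.map_pow]; exact Ideal.pow_right_mono h1 n
    exact h2 (Ideal.mem_map_of_mem s ha)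
  -- Picard iteration from 0: every application of b ↦ r * s b + y multiplies the error by r ∈ I.
  let u : ℕ → A := fun n ↦ Nat.rec 0 (fun _ b ↦ r * s b + y) n
  have hu : ∀ n, u (n + 1) = r * s (u n) + y := fun n ↦ rfl
  have hstep : ∀ n, u (n + 1) - u n ∈ I ^ n := by
    intro n
    induction n with
    | zero => simp
    | succ n ih =>
      have : u (n + 1 + 1) - u (n + 1) = r * s (u (n + 1) - u n) := by
        rw [hu (n + 1), hu n, map_sub, ← hu n]; ring
      rw [this, pow_succ']
      exact Ideal.mul_mem_mul hr (hs' _ _ ih)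
  have hcauchy : ∀ {m n}, m ≤ n → u m ≡ u n [SMOD (I ^ m • ⊤ : Submodule A A)] := by
    intro m n hmn
    rw [SModEq.sub_mem, smul_eq_mul, Ideal.mul_top]
    induction n, hmn using Nat.le_induction with
    | base => simp
    | succ n hmn ih =>
      have : u m - u (n + 1) = (u m - u n) - (u (n + 1) - u n) := by ring
      rw [this]
      exact sub_mem ih (Ideal.pow_le_pow_right hmn (hstep n))
  obtain ⟨b, hb⟩ := IsPrecomplete.prec' (I := I) u hcauchy
  refine ⟨b, ?_⟩
  rw [← sub_eq_zero]
  refine IsHausdorff.haus' (I := I) _ fun n ↦ ?_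
  have hn := hb n
  have hn' := hb (n + 1)
  rw [SModEq.sub_mem, smul_eq_mul, Ideal.mul_top] at hn hn'
  rw [SModEq.zero, smul_eq_mul, Ideal.mul_top]
  have : b - (r * s b + y) = r * s (u n - b) - (u (n + 1) - b) := by
    rw [hu, map_sub]; ring
  rw [this]
  exact sub_mem (Ideal.mul_mem_left _ _ (hs' _ _ hn)) (Ideal.pow_le_pow_right n.le_succ hn')

end FixedPoint

/-! ### Relative Lubin–Tate polynomials -/

/-- The conditions on a relative Lubin–Tate polynomial over a local ring `A`, for the exponent
`q`. -/
structure IsLT {A : Type*} [CommRing A] [IsLocalRing A] (q : ℕ) (f : A[X]) : Prop where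
  monic : f.Monic
  coeff_zero : f.coeff 0 = 0
  coeff_one : Irreducible (f.coeff 1)
  map_residue : f.map (residue A) = X ^ q

/-- A lift to `A` of the `q`-power map of the residue field. -/
def IsFrobeniusLift {A : Type*} [CommRing A] [IsLocalRing A] (q : ℕ) (s : A ≃+* A) : Prop :=
  ∀ a, residue A (s a) = residue A a ^ q

section Basic

variable {A : Type*} [CommRing A] [IsLocalRing A] {q : ℕ}

theorem map_mem_maximalIdeal (s : A ≃+* A) {a : A} (ha : a ∈ maximalIdeal A) :
    s a ∈ maximalIdeal A := by
  rw [mem_maximalIdeal, mem_nonunits_iff] at ha ⊢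
  simpa using ha

theorem IsLT.map {f : A[X]} (hf : IsLT q f) (s : A ≃+* A) : IsLT q (f.map (s : A →+* A)) where
  monic := hf.monic.map _
  coeff_zero := by simp [hf.coeff_zero]
  coeff_one := by
    rw [coeff_map]
    exact (MulEquiv.irreducible_iff s.toMulEquiv).2 hf.coeff_one
  map_residue := by
    ext i
    have h := congrArg (fun p ↦ p.coeff i) hf.map_residue
    simp only [coeff_map, coeff_X_pow] at h ⊢
    have h0 : f.coeff i - (if i = q then 1 else 0) ∈ maximalIdeal A := by
      rw [← residue_eq_zero_iff, map_sub, h]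
      split_ifs <;> simp
    have h1 := map_mem_maximalIdeal s h0
    rw [← residue_eq_zero_iff, map_sub, map_sub, sub_eq_zero] at h1
    rw [RingHom.coe_coe, h1]
    split_ifs <;> simp

theorem IsLT.natDegree {f : A[X]} (hf : IsLT q f) : f.natDegree = q := by
  rw [← hf.monic.natDegree_map (residue A), hf.map_residue, natDegree_X_pow]

theorem IsLT.eq_X_mul_divX {f : A[X]} (hf : IsLT q f) : f = X * f.divX := by
  conv_lhs => rw [← divX_mul_X_add f, hf.coeff_zero]
  rw [C_0, add_zero, mul_comm]

theorem IsLT.map_divX {f : A[X]} (hf : IsLT q f) (hq : 1 ≤ q) :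
    f.divX.map (residue A) = X ^ (q - 1) := by
  have := hf.map_residue
  rw [hf.eq_X_mul_divX, Polynomial.map_mul, map_X] at this
  have h2 : (X : (ResidueField A)[X]) ^ q = X * X ^ (q - 1) := by
    rw [← pow_succ', Nat.sub_add_cancel hq]
  rw [h2] at this
  exact mul_left_cancel₀ X_ne_zero this

omit [IsLocalRing A] in
theorem coeff_zero_divX (f : A[X]) : f.divX.coeff 0 = f.coeff 1 := by
  simp [coeff_divX]

end Basic

/-! ### Power series commuting with f -/

section Approximation

theorem pow_eq_X_pow_mul_divX_pow {A : Type*} [CommRing A] {f : A[X]} (hf : f.coeff 0 = 0)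
    (j : ℕ) : f ^ j = X ^ j * f.divX ^ j := by
  have : f = X * f.divX := by
    conv_lhs => rw [← divX_mul_X_add f, hf, C_0, add_zero, mul_comm]
  conv_lhs => rw [this, mul_pow]

theorem coe_comp {A : Type*} [CommRing A] (f h : A[X]) :
    ((f.comp h : A[X]) : PowerSeries A) = aeval (h : PowerSeries A) f := by
  rw [comp, ← coeToPowerSeries.ringHom_apply, hom_eval₂, aeval_def]
  congr 1
  ext a : 1
  simp

section LocalRing

variable {A : Type*} [CommRing A] [IsLocalRing A] {q p k : ℕ} [Fact p.Prime]
  [CharP (ResidueField A) p] {f : A[X]} {s : A ≃+* A}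

/-- Modulo the maximal ideal f is X^q and s raises coefficients to the q-th power, so both
composites reduce to the q-th power of the reduction of h. Hence the obstruction in each degree is a
multiple of the uniformizer. -/
theorem map_residue_comp_sub_comp (hq : q = p ^ k) (hf : IsLT q f) (hs : IsFrobeniusLift q s)
    (h : A[X]) :
    (f.comp h - (h.map (s : A →+* A)).comp f).map (residue A) = 0 := by
  rw [Polynomial.map_sub, map_comp, map_comp, hf.map_residue, X_pow_comp, sub_eq_zero, hq,
    ← map_iterateFrobenius_expand, expand_eq_comp_X_pow, map_comp]
  congr 1
  · ext i
    simp [iterateFrobenius_def, hs (h.coeff i), hq]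
  · simp

end LocalRing

variable {A : Type*} [CommRing A] [IsDomain A] [IsDiscreteValuationRing A]
  [IsAdicComplete (maximalIdeal A) A] {q p k : ℕ} [Fact p.Prime]
  [CharP (ResidueField A) p] {f : A[X]} {s : A ≃+* A}

/-- One step of the successive approximation of a power series commuting with `f`. -/
theorem exists_approx_step (hq : q = p ^ k) (hf : IsLT q f) (hs : IsFrobeniusLift q s) (j : ℕ)
    (h : A[X]) (hX : X ∣ h) (hh : X ^ (j + 2) ∣ f.comp h - (h.map (s : A →+* A)).comp f) :
    ∃ h' : A[X], X ^ (j + 2) ∣ h' - h ∧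
      X ^ (j + 2 + 1) ∣ f.comp h' - (h'.map (s : A →+* A)).comp f := by
  obtain ⟨u, hu⟩ := hh
  have hc : u.coeff 0 ∈ maximalIdeal A := by
    have h1 := congrArg (fun P ↦ P.coeff (j + 2)) (map_residue_comp_sub_comp hq hf hs h)
    simp only [coeff_map, coeff_zero] at h1
    rw [hu, coeff_X_pow_mul' , if_pos le_rfl, Nat.sub_self] at h1
    rwa [residue_eq_zero_iff] at h1
  rw [hf.coeff_one.maximalIdeal_eq, Ideal.mem_span_singleton] at hc
  obtain ⟨c, hc⟩ := hc
  set π := f.coeff 1 with hπ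
  have hπmem : π ∈ maximalIdeal A := by
    rw [hf.coeff_one.maximalIdeal_eq]; exact Ideal.mem_span_singleton_self _
  -- Adding b X^(j+2) to h changes the coefficient of X^(j+2) in the defect to π c + π b - s(b)
  -- π^(j+2). It vanishes if b = π^(j+1) s(b) - c.
  obtain ⟨b, hb⟩ := exists_eq_mul_map_add (maximalIdeal A) (s : A →+* A)
    (fun a ha ↦ map_mem_maximalIdeal s ha) (r := π ^ (j + 1))
    (Ideal.pow_mem_of_mem _ hπmem _ (by omega)) (-c)
  set d : A[X] := C b * X ^ (j + 2) with hd
  refine ⟨h + d, ⟨C b, by rw [hd]; ring⟩, ?_⟩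
  obtain ⟨v, hv⟩ : ∃ v, f.comp (h + d) = f.comp h + (derivative f).comp h * d + v * d ^ 2 := by
    obtain ⟨v, hv⟩ := (f.map C).binomExpansion h d
    refine ⟨v, ?_⟩
    simp only [eval_map, derivative_map] at hv
    exact hv
  have hexp : f.comp (h + d) - ((h + d).map (s : A →+* A)).comp f
      = X ^ (j + 2) * (u + (derivative f).comp h * C b + v * (C b ^ 2 * X ^ (j + 2))
        - C (s b) * f.divX ^ (j + 2)) := by
    have e1 : ((h + d).map (s : A →+* A)).comp f
        = (h.map (s : A →+* A)).comp f + C (s b) * (X ^ (j + 2) * f.divX ^ (j + 2)) := by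
      rw [Polynomial.map_add, add_comp, hd, Polynomial.map_mul, map_C, Polynomial.map_pow, map_X,
        mul_comp, C_comp, X_pow_comp, pow_eq_X_pow_mul_divX_pow hf.coeff_zero]
      rfl
    rw [e1, hv, ← sub_eq_zero]
    have := hu
    rw [sub_eq_iff_eq_add] at this
    rw [this, hd]
    ring
  rw [hexp, pow_succ]
  refine mul_dvd_mul_left _ ?_
  rw [X_dvd_iff]
  have hh0 : h.eval 0 = 0 := by rwa [← coeff_zero_eq_eval_zero, ← X_dvd_iff]
  have hf0 : (derivative f).eval 0 = π := by
    rw [← coeff_zero_eq_eval_zero, coeff_derivative]; simp [hπ]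
  have hd0 : f.divX.eval 0 = π := by
    rw [← coeff_zero_eq_eval_zero, coeff_zero_divX]
  rw [coeff_zero_eq_eval_zero] at hc ⊢
  simp only [eval_add, eval_sub, eval_mul, eval_pow, eval_comp, eval_C, eval_X, hh0, hf0, hd0, hc]
  rw [RingHom.coe_coe] at hb
  have : (0 : A) ^ (j + 2) = 0 := by simp
  rw [this]
  linear_combination π * hb

/-- A sequence of polynomials that converges to a power series commuting with `f`. -/
theorem exists_approx_seq (hq : q = p ^ k) (hf : IsLT q f) (hs : IsFrobeniusLift q s) {a : A}
    (ha : s a = a) : ∃ H : ℕ → A[X], H 0 = C a * X ∧ (∀ n, X ^ (n + 2) ∣ H (n + 1) - H n) ∧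
      ∀ n, X ^ (n + 2) ∣ f.comp (H n) - ((H n).map (s : A →+* A)).comp f := by
  let P : ℕ → A[X] → Prop := fun n h ↦
    X ∣ h ∧ X ^ (n + 2) ∣ f.comp h - (h.map (s : A →+* A)).comp f
  -- The linear terms of the two composites are π a and s(a) π, which agree because s fixes a.
  have h0 : P 0 (C a * X) := by
    refine ⟨dvd_mul_left _ _, ?_⟩
    obtain ⟨v, hv⟩ : ∃ v, f.comp (0 + C a * X) =
        f.comp 0 + (derivative f).comp 0 * (C a * X) + v * (C a * X) ^ 2 := by
      obtain ⟨v, hv⟩ := (f.map C).binomExpansion 0 (C a * X)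
      refine ⟨v, ?_⟩
      simp only [eval_map, derivative_map] at hv
      exact hv
    have e0 : f.comp 0 = 0 := by
      rw [comp_zero, ← coeff_zero_eq_eval_zero, hf.coeff_zero, C_0]
    have e1 : (derivative f).comp 0 = C (f.coeff 1) := by
      rw [comp_zero, ← coeff_zero_eq_eval_zero, coeff_derivative]; simp
    rw [zero_add, e0, e1] at hv
    have e2 : f = X * (C (f.coeff 1) + X * f.divX.divX) := by
      conv_lhs => rw [hf.eq_X_mul_divX, ← divX_mul_X_add f.divX, coeff_zero_divX]
      ring
    have e3 : ((C a * X).map (s : A →+* A)).comp f = C a * f := by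
      simp [ha]
    rw [e3, hv]
    conv in C a * f => rw [e2]
    refine ⟨v * C a ^ 2 - C a * f.divX.divX, ?_⟩
    ring
  have hstep : ∀ n h, P n h → ∃ h', X ^ (n + 2) ∣ h' - h ∧ P (n + 1) h' := by
    rintro n h ⟨h1, h2⟩
    obtain ⟨h', h3, h4⟩ := exists_approx_step hq hf hs n h h1 h2
    refine ⟨h', h3, ?_, h4⟩
    have := dvd_add ((dvd_pow_self X (by omega : n + 2 ≠ 0)).trans h3) h1
    simpa using this
  choose! step hst1 hst2 using hstep
  let H : ℕ → A[X] := fun n ↦ Nat.rec (C a * X) (fun n h ↦ step n h) n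
  have hP : ∀ n, P n (H n) := by
    intro n
    induction n with
    | zero => exact h0
    | succ n ih => exact hst2 n _ ih
  exact ⟨H, rfl, fun n ↦ hst1 n _ (hP n), fun n ↦ (hP n).2⟩

/-- **Lubin–Tate lemma**: every `a` fixed by `s` is the linear coefficient of a power series `h`
with `f ∘ h = h^s ∘ f`. -/
theorem exists_powerSeries_comm (hq : q = p ^ k) (hf : IsLT q f) (hs : IsFrobeniusLift q s) {a : A}
    (ha : s a = a) : ∃ h : PowerSeries A, h.constantCoeff = 0 ∧ h.coeff 1 = a ∧
      aeval h f = PowerSeries.subst (f : PowerSeries A) (h.map (s : A →+* A)) := by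
  obtain ⟨H, hH0, hHd, hHc⟩ := exists_approx_seq hq hf hs ha
  have hmono : ∀ n m, n ≤ m → X ^ (n + 2) ∣ H m - H n := by
    intro n m hnm
    induction m, hnm using Nat.le_induction with
    | base => simp
    | succ m hm ih =>
      have : H (m + 1) - H n = (H (m + 1) - H m) + (H m - H n) := by ring
      rw [this]
      exact dvd_add ((pow_dvd_pow X (by omega)).trans (hHd m)) ih
  have hcoeff : ∀ i n m, i < n + 2 → n ≤ m → (H m).coeff i = (H n).coeff i := by
    intro i n m hi hnm
    rw [← sub_eq_zero, ← coeff_sub]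
    exact X_pow_dvd_iff.1 (hmono n m hnm) i hi
  -- The limit, read off diagonally: the coefficient of degree n no longer changes after `H n`.
  let h : PowerSeries A := PowerSeries.mk fun n ↦ (H n).coeff n
  have hh : ∀ n, (PowerSeries.X : PowerSeries A) ^ (n + 1) ∣ h - (H n : PowerSeries A) := by
    intro n
    rw [PowerSeries.X_pow_dvd_iff]
    intro i hi
    rw [map_sub, PowerSeries.coeff_mk, coeff_coe, sub_eq_zero]
    exact (hcoeff i i n (by omega) (by omega)).symm
  have hsubst : PowerSeries.HasSubst (f : PowerSeries A) :=
    PowerSeries.HasSubst.of_constantCoeff_zero' (by simp [hf.coeff_zero])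
  refine ⟨h, ?_, ?_, ?_⟩
  · rw [← PowerSeries.coeff_zero_eq_constantCoeff_apply, PowerSeries.coeff_mk, hH0]; simp
  · rw [PowerSeries.coeff_mk, hcoeff 1 0 1 (by omega) (by omega), hH0]; simp
  · rw [← sub_eq_zero]
    ext i
    rw [map_zero]
    -- Modulo X^(i+1) the series h may be replaced by `H i`: on the left because f is a polynomial,
    -- on the right because f has no constant term. The defect of `H i` is already controlled.
    have key : (PowerSeries.X : PowerSeries A) ^ (i + 1) ∣
        aeval h f - PowerSeries.subst (f : PowerSeries A) (h.map (s : A →+* A)) := by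
      have e1 : (PowerSeries.X : PowerSeries A) ^ (i + 1) ∣
          aeval h f - aeval (H i : PowerSeries A) f := by
        refine (hh i).trans ?_
        have := Polynomial.sub_dvd_eval_sub h (H i : PowerSeries A)
          (f.map (algebraMap A (PowerSeries A)))
        rwa [eval_map_algebraMap, eval_map_algebraMap] at this
      have e2 : (PowerSeries.X : PowerSeries A) ^ (i + 1) ∣
          PowerSeries.subst (f : PowerSeries A) (h.map (s : A →+* A)) -
          PowerSeries.subst (f : PowerSeries A) ((H i : PowerSeries A).map (s : A →+* A)) := by
        obtain ⟨w, hw⟩ := hh i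
        rw [← PowerSeries.subst_sub hsubst, ← map_sub, hw, map_mul, map_pow, PowerSeries.map_X,
          PowerSeries.subst_mul hsubst, PowerSeries.subst_pow hsubst, PowerSeries.subst_X hsubst]
        refine Dvd.dvd.mul_right (pow_dvd_pow_of_dvd ?_ _) _
        rw [PowerSeries.X_dvd_iff]; simp [hf.coeff_zero]
      have e3 : (PowerSeries.X : PowerSeries A) ^ (i + 1) ∣ aeval (H i : PowerSeries A) f -
          PowerSeries.subst (f : PowerSeries A) ((H i : PowerSeries A).map (s : A →+* A)) := by
        have e5 : PowerSeries.subst (f : PowerSeries A) ((H i : PowerSeries A).map (s : A →+* A))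
            = ((((H i).map (s : A →+* A)).comp f : A[X]) : PowerSeries A) := by
          rw [← Polynomial.polynomial_map_coe, PowerSeries.subst_coe hsubst, coe_comp]
        rw [← coe_comp, e5, ← coe_sub]
        obtain ⟨w, hw⟩ := hHc i
        rw [hw, coe_mul, coe_pow, coe_X, pow_succ _ (i + 1), mul_assoc]
        exact dvd_mul_right _ _
      have := dvd_add (dvd_sub e1 e2) e3
      convert! this using 1
      ring
    exact PowerSeries.X_pow_dvd_iff.1 key i (by omega)

end Approximation

/-! ### The iterates f_m and their primitive factors -/

section Level

variable {A : Type*} [CommRing A]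

/-- `levelPoly s f m = f^{s^{m-1}} ∘ ⋯ ∘ f^s ∘ f`. -/
noncomputable def levelPoly (s : A ≃+* A) (f : A[X]) : ℕ → A[X]
  | 0 => X
  | m + 1 => ((Polynomial.map (s : A →+* A))^[m] f).comp (levelPoly s f m)

/-- The quotient `levelPoly s f (m + 1) / levelPoly s f m`, whose roots are the primitive roots. -/
noncomputable def primPoly (s : A ≃+* A) (f : A[X]) (m : ℕ) : A[X] :=
  ((Polynomial.map (s : A →+* A))^[m] f).divX.comp (levelPoly s f m)

variable {s : A ≃+* A} {f : A[X]}

theorem iterate_map_map (m : ℕ) : (Polynomial.map (s : A →+* A))^[m] (f.map (s : A →+* A)) =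
    ((Polynomial.map (s : A →+* A))^[m] f).map (s : A →+* A) := by
  rw [← Function.iterate_succ_apply, Function.iterate_succ_apply']

theorem divX_map {B : Type*} [CommRing B] (g : A →+* B) (f : A[X]) :
    (f.map g).divX = f.divX.map g := by
  ext i; simp [coeff_divX]

theorem levelPoly_map (m : ℕ) : levelPoly s (f.map (s : A →+* A)) m =
    (levelPoly s f m).map (s : A →+* A) := by
  induction m with
  | zero => simp [levelPoly]
  | succ m ih => rw [levelPoly, levelPoly, ih, iterate_map_map, map_comp]

theorem primPoly_map (m : ℕ) : primPoly s (f.map (s : A →+* A)) m =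
    (primPoly s f m).map (s : A →+* A) := by
  rw [primPoly, primPoly, levelPoly_map, iterate_map_map, map_comp, divX_map]

/-- Splits off the innermost f instead of the outermost twist, at the cost of twisting the rest.
Inductions that involve D^s ∘ f need this form. -/
theorem levelPoly_succ' (m : ℕ) :
    levelPoly s f (m + 1) = (levelPoly s (f.map (s : A →+* A)) m).comp f := by
  induction m with
  | zero => simp [levelPoly]
  | succ m ih =>
    rw [levelPoly, ih, levelPoly, ← comp_assoc, Function.iterate_succ_apply]

theorem primPoly_succ' (m : ℕ) :
    primPoly s f (m + 1) = (primPoly s (f.map (s : A →+* A)) m).comp f := by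
  rw [primPoly, primPoly, levelPoly_succ', comp_assoc, Function.iterate_succ_apply]

variable [IsLocalRing A] {q : ℕ}

theorem IsLT.iterate_map (hf : IsLT q f) (s : A ≃+* A) (m : ℕ) :
    IsLT q ((Polynomial.map (s : A →+* A))^[m] f) := by
  induction m with
  | zero => exact hf
  | succ m ih => rw [Function.iterate_succ_apply']; exact ih.map s

theorem levelPoly_succ (hf : IsLT q f) (m : ℕ) :
    levelPoly s f (m + 1) = levelPoly s f m * primPoly s f m := by
  rw [levelPoly, (hf.iterate_map s m).eq_X_mul_divX, mul_comp, X_comp, primPoly]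

theorem levelPoly_coeff_zero (hf : IsLT q f) (m : ℕ) : (levelPoly s f m).coeff 0 = 0 := by
  induction m with
  | zero => simp [levelPoly]
  | succ m ih => rw [levelPoly_succ hf, mul_coeff_zero, ih, zero_mul]

theorem levelPoly_map_residue (hf : IsLT q f) (m : ℕ) :
    (levelPoly s f m).map (residue A) = X ^ q ^ m := by
  induction m with
  | zero => simp [levelPoly]
  | succ m ih =>
    rw [levelPoly, map_comp, ih, (hf.iterate_map s m).map_residue, X_pow_comp, ← pow_mul, pow_succ]

theorem primPoly_map_residue (hq : 1 ≤ q) (hf : IsLT q f) (m : ℕ) :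
    (primPoly s f m).map (residue A) = X ^ (q ^ m * (q - 1)) := by
  rw [primPoly, map_comp, levelPoly_map_residue hf, (hf.iterate_map s m).map_divX hq, X_pow_comp,
    ← pow_mul]

theorem levelPoly_monic (hq : 1 ≤ q) (hf : IsLT q f) (m : ℕ) : (levelPoly s f m).Monic := by
  induction m with
  | zero => exact monic_X
  | succ m ih =>
    rw [levelPoly]
    refine (hf.iterate_map s m).monic.comp ih ?_
    rw [← ih.natDegree_map (residue A), levelPoly_map_residue hf, natDegree_X_pow]
    positivity

theorem primPoly_monic (hq : 1 ≤ q) (hf : IsLT q f) (m : ℕ) : (primPoly s f m).Monic := by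
  have := levelPoly_monic (s := s) hq hf (m + 1)
  rw [levelPoly_succ hf] at this
  exact (levelPoly_monic hq hf m).of_mul_monic_left this

theorem levelPoly_natDegree (hq : 1 ≤ q) (hf : IsLT q f) (m : ℕ) :
    (levelPoly s f m).natDegree = q ^ m := by
  rw [← (levelPoly_monic hq hf m).natDegree_map (residue A), levelPoly_map_residue hf,
    natDegree_X_pow]

theorem primPoly_natDegree (hq : 1 ≤ q) (hf : IsLT q f) (m : ℕ) :
    (primPoly s f m).natDegree = q ^ m * (q - 1) := by
  rw [← (primPoly_monic hq hf m).natDegree_map (residue A), primPoly_map_residue hq hf,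
    natDegree_X_pow]

/-- Since f_m has no constant term, only the linear coefficient of the outer twist of f survives. It
is a uniformizer, which makes the primitive factor Eisenstein. -/
theorem primPoly_coeff_zero (hf : IsLT q f) (m : ℕ) :
    (primPoly s f m).coeff 0 = ((Polynomial.map (s : A →+* A))^[m] f).coeff 1 := by
  rw [coeff_zero_eq_eval_zero, primPoly, eval_comp, ← coeff_zero_eq_eval_zero (levelPoly s f m),
    levelPoly_coeff_zero hf, ← coeff_zero_eq_eval_zero, coeff_zero_divX]

theorem primPoly_coeff_zero_irreducible (hf : IsLT q f) (m : ℕ) :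
    Irreducible ((primPoly s f m).coeff 0) := by
  rw [primPoly_coeff_zero hf]
  exact (hf.iterate_map s m).coeff_one

theorem isWeaklyEisensteinAt_of_map_residue {g : A[X]} (hm : g.Monic) {d : ℕ}
    (h : g.map (residue A) = X ^ d) : g.IsWeaklyEisensteinAt (maximalIdeal A) where
  mem := by
    intro i hi
    have hd : g.natDegree = d := by rw [← hm.natDegree_map (residue A), h, natDegree_X_pow]
    have := congrArg (fun P ↦ P.coeff i) h
    simp only [coeff_map, coeff_X_pow] at this
    rwa [if_neg (by omega), residue_eq_zero_iff] at this

theorem primPoly_isDistinguishedAt (hq : 1 ≤ q) (hf : IsLT q f) (m : ℕ) :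
    (primPoly s f m).IsDistinguishedAt (maximalIdeal A) where
  toIsWeaklyEisensteinAt :=
    isWeaklyEisensteinAt_of_map_residue (primPoly_monic hq hf m) (primPoly_map_residue hq hf m)
  monic := primPoly_monic hq hf m

theorem levelPoly_coeff_one (hf : IsLT q f) (m : ℕ) :
    (levelPoly s f (m + 1)).coeff 1 =
      (levelPoly s f m).coeff 1 * (primPoly s f m).coeff 0 := by
  rw [levelPoly_succ hf, mul_coeff_one, levelPoly_coeff_zero hf]
  ring

end Level

/-! ### Divisibility by primitive factors in the power series ring -/

section DVR

variable {A : Type*} [CommRing A] [IsDomain A] [IsDiscreteValuationRing A] {q : ℕ} {f : A[X]}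
  {s : A ≃+* A}

/-- The linear coefficient of f_m is a product of m conjugates of the uniformizer π. This converts
divisibility by f_m into a congruence modulo ϖ^m. -/
theorem pow_dvd_levelPoly_coeff_one (hf : IsLT q f) {ϖ : A} (hϖ : Irreducible ϖ) (m : ℕ) :
    ϖ ^ m ∣ (levelPoly s f m).coeff 1 := by
  induction m with
  | zero => simp
  | succ m ih =>
    rw [levelPoly_coeff_one hf, pow_succ]
    exact mul_dvd_mul ih (IsDiscreteValuationRing.associated_of_irreducible A hϖ
      (primPoly_coeff_zero_irreducible hf m)).dvd

theorem primPoly_isEisensteinAt (hq : 2 ≤ q) (hf : IsLT q f) (m : ℕ) :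
    (primPoly s f m).IsEisensteinAt (maximalIdeal A) where
  leading := by
    rw [(primPoly_monic (by omega) hf m).leadingCoeff]
    exact (Ideal.ne_top_iff_one _).1 (maximalIdeal.isMaximal A).ne_top
  mem := (isWeaklyEisensteinAt_of_map_residue (primPoly_monic (by omega) hf m)
    (primPoly_map_residue (by omega) hf m)).mem
  notMem := by
    have h := primPoly_coeff_zero_irreducible (s := s) hf m
    rw [h.maximalIdeal_eq, Ideal.span_singleton_pow, Ideal.mem_span_singleton]
    intro hd
    obtain ⟨c, hc⟩ := hd
    rw [pow_two, mul_assoc] at hc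
    have h1 := mul_left_cancel₀ h.ne_zero ((mul_one _).trans hc)
    exact h.not_isUnit (.of_mul_eq_one _ h1.symm)

theorem primPoly_irreducible (hq : 2 ≤ q) (hf : IsLT q f) (m : ℕ) :
    Irreducible (primPoly s f m) := by
  refine (primPoly_isEisensteinAt hq hf m).irreducible (maximalIdeal.isMaximal A).isPrime
    (primPoly_monic (by omega) hf m).isPrimitive ?_
  rw [primPoly_natDegree (by omega) hf]
  have : 0 < q - 1 := by omega
  positivity

variable [IsAdicComplete (maximalIdeal A) A]

/-- A distinguished prime polynomial stays prime in the ring of power series. -/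
theorem prime_coe_of_prime {g : A[X]} (hg : g.IsDistinguishedAt (maximalIdeal A)) (hp : Prime g) :
    Prime (g : PowerSeries A) := by
  have h1 : (Ideal.span {g}).IsPrime := (Ideal.span_singleton_prime hp.ne_zero).2 hp
  have : IsDomain (A[X] ⧸ Ideal.span {g}) := (Ideal.Quotient.isDomain_iff_prime _).2 h1
  have h2 : IsDomain (PowerSeries A ⧸ Ideal.span {(g : PowerSeries A)}) :=
    hg.algEquivQuotient.symm.toMulEquiv.isDomain _
  rw [Ideal.Quotient.isDomain_iff_prime] at h2
  refine (Ideal.span_singleton_prime ?_).1 h2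
  simpa using hp.ne_zero

/-- Divisibility by a distinguished polynomial can be tested modulo it. -/
theorem dvd_of_coe_dvd_coe {g : A[X]} (hg : g.IsDistinguishedAt (maximalIdeal A)) {r : A[X]}
    (h : (g : PowerSeries A) ∣ (r : PowerSeries A)) : g ∣ r := by
  have h1 : Ideal.Quotient.mk (Ideal.span {(g : PowerSeries A)}) (r : PowerSeries A) = 0 :=
    Ideal.Quotient.eq_zero_iff_dvd _ _ |>.2 h
  have h2 : hg.algEquivQuotient (Ideal.Quotient.mk _ r) = 0 := by
    rw [← h1]; simp
  rw [EmbeddingLike.map_eq_zero_iff] at h2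
  exact Ideal.Quotient.eq_zero_iff_dvd _ _ |>.1 h2

theorem exists_coe_dvd_sub {g : A[X]} (hg : g.IsDistinguishedAt (maximalIdeal A))
    (D : PowerSeries A) : ∃ r : A[X], (g : PowerSeries A) ∣ D - r := by
  obtain ⟨x, hx⟩ := hg.algEquivQuotient.surjective (Ideal.Quotient.mk _ D)
  obtain ⟨r, rfl⟩ := Ideal.Quotient.mk_surjective x
  refine ⟨r, ?_⟩
  rw [← Ideal.Quotient.eq_zero_iff_dvd, map_sub, ← hx]
  simp

theorem subst_dvd_subst {A : Type*} [CommRing A] {a : PowerSeries A} (ha : PowerSeries.HasSubst a)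
    {u v : PowerSeries A}     (h : u ∣ v) : PowerSeries.subst a u ∣ PowerSeries.subst a v := by
  obtain ⟨w, rfl⟩ := h
  rw [PowerSeries.subst_mul ha]
  exact dvd_mul_right _ _

theorem IsLT.hasSubst {A : Type*} [CommRing A] [IsLocalRing A] {f : A[X]} (hf : IsLT q f) :
    PowerSeries.HasSubst (f : PowerSeries A) :=
  PowerSeries.HasSubst.of_constantCoeff_zero' (by simp [hf.coeff_zero])

theorem subst_coe_eq_comp {A : Type*} [CommRing A] {f : A[X]}
    (hf : PowerSeries.HasSubst (f : PowerSeries A)) (g : A[X]) :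
    PowerSeries.subst (f : PowerSeries A) (g : PowerSeries A)
      = ((g.comp f : A[X]) : PowerSeries A) := by
  rw [PowerSeries.subst_coe hf, coe_comp]

/-- Let r₀ be the remainder of r modulo g. Then g ∘ f divides r₀ ∘ f, whose degree is too small
unless r₀ = 0. -/
theorem dvd_of_comp_dvd_comp {A : Type*} [CommRing A] [IsDomain A] {f g r : A[X]} (hg : g.Monic)
    (hf : f.natDegree ≠ 0) (h : g.comp f ∣ r.comp f) : g ∣ r := by
  rw [← modByMonic_eq_zero_iff_dvd hg]
  by_contra hne
  have h1 : g.comp f ∣ (r %ₘ g).comp f := by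
    rw [modByMonic_eq_sub_mul_div, sub_comp, mul_comp]
    exact dvd_sub h (dvd_mul_right _ _)
  have h2 : (r %ₘ g).comp f ≠ 0 := by
    intro h0
    rw [comp_eq_zero_iff] at h0
    rcases h0 with h0 | ⟨-, h0⟩
    · exact hne h0
    · exact hf (by rw [h0, natDegree_C])
  have h3 := natDegree_le_of_dvd h1 h2
  rw [natDegree_comp, natDegree_comp] at h3
  have h4 := natDegree_modByMonic_lt r hg (by
    rintro rfl
    simp at hne)
  have := Nat.le_of_mul_le_mul_right h3 (Nat.pos_of_ne_zero hf)
  omega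

/-- If `g ∘ f` divides `D ∘ f`, then `g` divides `D`. -/
theorem dvd_of_comp_dvd_subst {g : A[X]} (hf : IsLT q f) (hq : 1 ≤ q)
    (hg : g.IsDistinguishedAt (maximalIdeal A))
    (hgf : (g.comp f).IsDistinguishedAt (maximalIdeal A)) {D : PowerSeries A}
    (h : ((g.comp f : A[X]) : PowerSeries A) ∣ PowerSeries.subst (f : PowerSeries A) D) :
    (g : PowerSeries A) ∣ D := by
  obtain ⟨r, hr⟩ := exists_coe_dvd_sub hg D
  have h1 := subst_dvd_subst hf.hasSubst hr
  rw [PowerSeries.subst_sub hf.hasSubst, subst_coe_eq_comp hf.hasSubst,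
    subst_coe_eq_comp hf.hasSubst] at h1
  have h2 := dvd_of_coe_dvd_coe hgf ((dvd_sub_right h).1 h1)
  have h3 := dvd_of_comp_dvd_comp hg.monic (by rw [hf.natDegree]; omega) h2
  obtain ⟨w, rfl⟩ := h3
  have h4 : (g : PowerSeries A) ∣ ((g * w : A[X]) : PowerSeries A) := by
    rw [coe_mul]; exact dvd_mul_right _ _
  simpa using dvd_add hr h4

theorem map_dvd_map_iff {A : Type*} [CommRing A] (s : A ≃+* A) {u v : PowerSeries A} :
    u.map (s : A →+* A) ∣ v.map (s : A →+* A) ↔ u ∣ v := by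
  refine ⟨fun h ↦ ?_, fun h ↦ map_dvd _ h⟩
  have := map_dvd (PowerSeries.map (s.symm : A →+* A)) h
  have hc : ∀ w : PowerSeries A, (w.map (s : A →+* A)).map (s.symm : A →+* A) = w := by
    intro w; ext i; simp
  rwa [hc, hc] at this

omit [IsAdicComplete (maximalIdeal A) A] in
-- Modulo f_m the primitive factor is a nonzero constant, so if it divided f_m it would divide that
-- constant, against its positive degree.
theorem primPoly_not_dvd_levelPoly (hq : 2 ≤ q) (hf : IsLT q f) (m : ℕ) :
    ¬ primPoly s f m ∣ levelPoly s f m := by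
  intro h
  have h1 : primPoly s f m = levelPoly s f m *
      (((Polynomial.map (s : A →+* A))^[m] f).divX.divX.comp (levelPoly s f m)) +
      C ((primPoly s f m).coeff 0) := by
    rw [primPoly_coeff_zero hf, primPoly]
    conv_lhs => rw [← divX_mul_X_add ((Polynomial.map (s : A →+* A))^[m] f).divX]
    rw [add_comp, mul_comp, X_comp, C_comp, coeff_zero_divX, mul_comm]
  have h2 : primPoly s f m ∣ C ((primPoly s f m).coeff 0) := by
    have := dvd_refl (primPoly s f m)
    conv_rhs at this => rw [h1]
    exact (dvd_add_right (h.mul_right _)).1 this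
  have h3 := natDegree_le_of_dvd h2
    (C_ne_zero.2 (primPoly_coeff_zero_irreducible hf m).ne_zero)
  rw [natDegree_C, primPoly_natDegree (by omega) hf] at h3
  have : 0 < q - 1 := by omega
  have : 0 < q ^ m * (q - 1) := by positivity
  omega

/-- If `D` divides `D^s ∘ f`, then the primitive polynomial of a level can divide `D` only if the
whole polynomial of this level divides it. -/
theorem levelPoly_dvd_of_primPoly_dvd (hq : 2 ≤ q) (hf : IsLT q f) {D : PowerSeries A}
    (hD0 : D.constantCoeff = 0)
    (hD : D ∣ PowerSeries.subst (f : PowerSeries A) (D.map (s : A →+* A))) (m : ℕ)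
    (h : (primPoly s f m : PowerSeries A) ∣ D) :
    (levelPoly s f (m + 1) : PowerSeries A) ∣ D := by
  have hlevel : ∀ m, (primPoly s f m : PowerSeries A) ∣ D → (levelPoly s f m : PowerSeries A) ∣ D →
      (levelPoly s f (m + 1) : PowerSeries A) ∣ D := by
    rintro m h ⟨w, rfl⟩
    have hdist := primPoly_isDistinguishedAt (s := s) (by omega) hf m
    rw [levelPoly_succ hf, coe_mul]
    refine mul_dvd_mul_left _ ?_
    refine ((prime_coe_of_prime hdist (primPoly_irreducible hq hf m).prime).dvd_or_dvd
      h).resolve_left fun h' ↦ ?_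
    exact primPoly_not_dvd_levelPoly hq hf m (dvd_of_coe_dvd_coe hdist h')
  induction m with
  | zero =>
    refine hlevel 0 h ?_
    rw [levelPoly, coe_X, PowerSeries.X_dvd_iff]
    exact hD0
  | succ m ih =>
    -- Descent: the factor of level m + 1 divides D, hence D^s ∘ f. It is the s-twisted factor of
    -- level m composed with f; cancelling f and undoing the twist shows that the factor of level m
    -- divides D.
    refine hlevel (m + 1) h (ih ?_)
    rw [← map_dvd_map_iff s, ← polynomial_map_coe, ← primPoly_map]
    refine dvd_of_comp_dvd_subst hf (by omega)
      (primPoly_isDistinguishedAt (by omega) (hf.map s) m) ?_ ?_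
    · rw [← primPoly_succ']
      exact primPoly_isDistinguishedAt (by omega) hf (m + 1)
    · rw [← primPoly_succ']
      exact h.trans hD

/-- Power series commuting with `f` that agree at a primitive point of level `m + 1` have linear
coefficients that agree modulo `ϖ ^ (m + 1)`. -/
theorem pow_dvd_coeff_one_sub (hq : 2 ≤ q) (hf : IsLT q f) {h₁ h₂ : PowerSeries A}
    (h₁0 : h₁.constantCoeff = 0) (h₂0 : h₂.constantCoeff = 0)
    (h₁c : aeval h₁ f = PowerSeries.subst (f : PowerSeries A) (h₁.map (s : A →+* A)))
    (h₂c : aeval h₂ f = PowerSeries.subst (f : PowerSeries A) (h₂.map (s : A →+* A))) (m : ℕ)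
    (h : (primPoly s f m : PowerSeries A) ∣ h₁ - h₂) {ϖ : A} (hϖ : Irreducible ϖ) :
    ϖ ^ (m + 1) ∣ h₁.coeff 1 - h₂.coeff 1 := by
  obtain ⟨w, hw⟩ := levelPoly_dvd_of_primPoly_dvd hq hf (by simp [h₁0, h₂0]) (by
    rw [map_sub, PowerSeries.subst_sub hf.hasSubst, ← h₁c, ← h₂c]
    have := Polynomial.sub_dvd_eval_sub h₁ h₂ (f.map (algebraMap A (PowerSeries A)))
    rwa [eval_map_algebraMap, eval_map_algebraMap] at this) m h
  rw [← map_sub, hw, PowerSeries.coeff_one_mul]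
  simp only [coeff_coe, constantCoeff_coe, levelPoly_coeff_zero hf]
  rw [mul_zero, add_zero]
  exact (pow_dvd_levelPoly_coeff_one hf hϖ (m + 1)).mul_right _

theorem aeval_map_eq_subst_map {A : Type*} [CommRing A] [IsLocalRing A] {q : ℕ} {f : A[X]}
    {s : A ≃+* A} (hf : IsLT q f) {h : PowerSeries A}
    (hc : aeval h f = PowerSeries.subst (f : PowerSeries A) (h.map (s : A →+* A))) :
    aeval (h.map (s : A →+* A)) (f.map (s : A →+* A)) =
      PowerSeries.subst ((f.map (s : A →+* A) : A[X]) : PowerSeries A)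
        ((h.map (s : A →+* A)).map (s : A →+* A)) := by
  have h1 : aeval (h.map (s : A →+* A)) (f.map (s : A →+* A)) =
      (aeval h f).map (s : A →+* A) := by
    rw [aeval_def, aeval_def, eval₂_map, hom_eval₂]
    congr 1
    ext a : 1
    simp
  rw [h1, hc, polynomial_map_coe]
  exact PowerSeries.map_subst hf.hasSubst _

/-- A power series commuting with `f` maps the roots of `levelPoly s f m` to themselves. -/
theorem levelPoly_dvd_aeval {A : Type*} [CommRing A] [IsLocalRing A] {q : ℕ} {f : A[X]}
    {s : A ≃+* A} (hf : IsLT q f) {h : PowerSeries A} (h0 : h.constantCoeff = 0)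
    (hc : aeval h f = PowerSeries.subst (f : PowerSeries A) (h.map (s : A →+* A))) (m : ℕ) :
    (levelPoly s f m : PowerSeries A) ∣ aeval h (levelPoly s f m) := by
  induction m generalizing f h with
  | zero =>
    rw [levelPoly, coe_X, aeval_X, PowerSeries.X_dvd_iff]
    exact h0
  | succ m ih =>
    have h0' : (h.map (s : A →+* A)).constantCoeff = 0 := by
      rw [← PowerSeries.coeff_zero_eq_constantCoeff_apply, PowerSeries.coeff_map,
        PowerSeries.coeff_zero_eq_constantCoeff_apply, h0, map_zero]
    have h1 := ih (hf.map s) (h := h.map (s : A →+* A)) h0'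
      (aeval_map_eq_subst_map hf hc)
    have h2 := subst_dvd_subst hf.hasSubst h1
    rw [subst_coe_eq_comp hf.hasSubst, ← levelPoly_succ'] at h2
    refine h2.trans (dvd_of_eq ?_)
    rw [levelPoly_succ', aeval_comp, hc, ← PowerSeries.coe_substAlgHom hf.hasSubst]
    rw [← Polynomial.aeval_algHom_apply]

end DVR

/-! ### Evaluation of power series at a root -/

section Evaluation

variable {A : Type*} [CommRing A] [IsDomain A] [IsDiscreteValuationRing A]
  [IsAdicComplete (maximalIdeal A) A] {B : Type*} [CommRing B] [IsDomain B] [Algebra A B]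
  [Module.IsTorsionFree A B]

omit [IsAdicComplete (maximalIdeal A) A] in
-- A discrete valuation ring is integrally closed, so a monic irreducible g is, up to a unit, the
-- minimal polynomial of its root over A.
theorem dvd_of_aeval_eq_zero {g : A[X]} (hm : g.Monic) (hg : Irreducible g) {α : B}
    (hα : aeval α g = 0) {p : A[X]} (hp : aeval α p = 0) : g ∣ p := by
  have hint : IsIntegral A α := ⟨g, hm, hα⟩
  have h1 := minpoly.isIntegrallyClosed_dvd hint hα
  have h2 : Associated (minpoly A α) g :=
    (hg.dvd_iff.1 h1).resolve_left (minpoly.not_isUnit A α) |>.symm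
  exact h2.symm.dvd.trans (minpoly.isIntegrallyClosed_dvd hint hp)

/-- Evaluation of power series at a root `α` of a distinguished irreducible polynomial `g`. -/
theorem exists_eval {g : A[X]} (hd : g.IsDistinguishedAt (maximalIdeal A)) (hg : Irreducible g)
    {α : B} (hα : aeval α g = 0) : ∃ ev : PowerSeries A →ₐ[A] B,
      (∀ p : A[X], ev p = aeval α p) ∧ (∀ D, ∃ p : A[X], ev D = aeval α p) ∧
      ∀ D, ev D = 0 ↔ (g : PowerSeries A) ∣ D := by
  -- Evaluation is the composite A[[X]] → A[[X]]/(g) ≅ A[X]/(g) → B, the middle step being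
  -- Weierstrass division; no topology on B is involved.
  let e := hd.algEquivQuotient
  let ψ : (A[X] ⧸ Ideal.span {g}) →ₐ[A] B := Ideal.Quotient.liftₐ _ (aeval α) (by
    intro a ha
    obtain ⟨w, rfl⟩ := Ideal.mem_span_singleton.1 ha
    rw [map_mul, hα, zero_mul])
  have hψ : ∀ p : A[X], ψ (Ideal.Quotient.mk _ p) = aeval α p := fun p ↦ rfl
  have he : ∀ p : A[X], e.symm (Ideal.Quotient.mk _ (p : PowerSeries A)) =
      Ideal.Quotient.mk _ p := by
    intro p
    rw [AlgEquiv.symm_apply_eq]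
    simp [e]
  let ev : PowerSeries A →ₐ[A] B := (ψ.comp e.symm.toAlgHom).comp (Ideal.Quotient.mkₐ A _)
  have hev : ∀ D, ev D = ψ (e.symm (Ideal.Quotient.mk _ D)) := fun D ↦ rfl
  have hevp : ∀ p : A[X], ev p = aeval α p := fun p ↦ by rw [hev, he, hψ]
  have hevg : ∀ D, (g : PowerSeries A) ∣ D → ev D = 0 := by
    rintro D ⟨w, rfl⟩
    rw [map_mul, hevp, hα, zero_mul]
  have hevs : ∀ D, ∃ p : A[X], (g : PowerSeries A) ∣ D - p ∧ ev D = aeval α p := by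
    intro D
    obtain ⟨p, hp⟩ := exists_coe_dvd_sub hd D
    refine ⟨p, hp, ?_⟩
    rw [← hevp, ← sub_eq_zero, ← map_sub]
    exact hevg _ hp
  refine ⟨ev, hevp, fun D ↦ (hevs D).imp fun p hp ↦ hp.2, fun D ↦ ⟨fun h ↦ ?_, hevg D⟩⟩
  obtain ⟨p, h1, h2⟩ := hevs D
  obtain ⟨w, rfl⟩ := dvd_of_aeval_eq_zero hd.monic hg hα (h2.symm.trans h)
  have h4 : (g : PowerSeries A) ∣ ((g * w : A[X]) : PowerSeries A) := by
    rw [coe_mul]; exact dvd_mul_right _ _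
  simpa using dvd_add h1 h4

end Evaluation

/-! ### Roots of f_m obtained from one primitive root -/

section Roots

variable {A : Type*} [CommRing A] [IsDomain A] [IsDiscreteValuationRing A]
  [IsAdicComplete (maximalIdeal A) A] {p k q : ℕ} [Fact p.Prime]
  [CharP (ResidueField A) p] {f : A[X]} {s : A ≃+* A} {B : Type*} [CommRing B] [IsDomain B]
  [Algebra A B] [Module.IsTorsionFree A B]

/-- Elements of `A` fixed by `s` and incongruent modulo `ϖ ^ (m + 1)` give distinct roots of
`levelPoly s f (m + 1)` that are polynomial expressions in a given primitive root. -/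
theorem exists_injective_roots (hq : q = p ^ k) (hq2 : 2 ≤ q) (hf : IsLT q f)
    (hs : IsFrobeniusLift q s) (m : ℕ) {α : B} (hα : aeval α (primPoly s f m) = 0)
    {ϖ : A} (hϖ : Irreducible ϖ) {ι : Type*}
    (c : ι → A) (hcs : ∀ i, s (c i) = c i)
    (hc : ∀ i j, ϖ ^ (m + 1) ∣ c i - c j → i = j) :
    ∃ ρ : ι → A[X], Function.Injective (fun i ↦ aeval α (ρ i)) ∧
      (∀ i, aeval (aeval α (ρ i)) (levelPoly s f (m + 1)) = 0) := by
  have hd := primPoly_isDistinguishedAt (s := s) (by omega) hf m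
  obtain ⟨ev, hevp, hevs, hev0⟩ := exists_eval hd (primPoly_irreducible hq2 hf m) hα
  choose h h0 h1 hcomm using fun i ↦ exists_powerSeries_comm hq hf hs (hcs i)
  choose ρ hρ using fun i ↦ hevs (h i)
  refine ⟨ρ, ?_, ?_⟩
  · intro i j hij
    refine hc i j ?_
    simp only [← hρ] at hij
    rw [← sub_eq_zero, ← map_sub, hev0] at hij
    rw [← h1 i, ← h1 j]
    exact pow_dvd_coeff_one_sub hq2 hf (h0 i) (h0 j) (hcomm i) (hcomm j) m hij hϖ
  · intro i
    rw [← hρ, Polynomial.aeval_algHom_apply]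
    obtain ⟨w, hw⟩ := levelPoly_dvd_aeval hf (h0 i) (hcomm i) (m + 1)
    rw [hw, map_mul, hevp, levelPoly_succ hf, map_mul, hα, mul_zero, zero_mul]

theorem eq_prod_X_sub_C_of_injective {B : Type*} [CommRing B] [IsDomain B] {P : B[X]}
    (hP : P.Monic) {ι : Type*} [Fintype ι] (hι : Fintype.card ι = P.natDegree) {ρ : ι → B}
    (hinj : Function.Injective ρ) (hroot : ∀ i, P.eval (ρ i) = 0) :
    P = ∏ i, (X - C (ρ i)) := by
  classical
  have h1 : (Finset.univ.image ρ).val ≤ P.roots := by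
    rw [Multiset.le_iff_subset (Finset.nodup _)]
    intro x hx
    obtain ⟨i, -, rfl⟩ := Finset.mem_image.1 hx
    exact (mem_roots hP.ne_zero).2 (hroot i)
  have h2 : P.roots = (Finset.univ.image ρ).val := by
    refine (Multiset.eq_of_le_of_card_le h1 ?_).symm
    rw [Finset.card_val, Finset.card_image_of_injective _ hinj, Finset.card_univ, hι]
    exact card_roots' P
  have h3 : Multiset.card P.roots = P.natDegree := by
    rw [h2, Finset.card_val, Finset.card_image_of_injective _ hinj, Finset.card_univ, hι]
  have h4 := prod_multiset_X_sub_C_of_monic_of_roots_card_eq hP h3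
  rw [← h4, h2]
  exact Finset.prod_image fun i _ j _ hij ↦ hinj hij

end Roots

/-! ### Integers in the extension generated by an Eisenstein root -/

section DVR

variable {A : Type*} [CommRing A] [IsDomain A] [IsDiscreteValuationRing A]
  [IsAdicComplete (maximalIdeal A) A] {B : Type*} [CommRing B] [IsDomain B] [Algebra A B]
  [Module.IsTorsionFree A B] {g : A[X]} {α : B}

/-- A root of an Eisenstein polynomial over a complete discrete valuation ring generates a discrete
valuation ring and is a uniformizer of it. -/
theorem isDiscreteValuationRing_of_root (hd : g.IsDistinguishedAt (maximalIdeal A))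
    (hg : Irreducible g) (hg0 : Irreducible (g.coeff 0)) (hα : aeval α g = 0)
    (hgen : ∀ b : B, ∃ p : A[X], b = aeval α p) :
    IsDiscreteValuationRing B ∧ Irreducible α := by
  obtain ⟨ev, hevp, -, hev0⟩ := exists_eval hd hg hα
  have hsurj : Function.Surjective ev := fun b ↦ by
    obtain ⟨p, rfl⟩ := hgen b
    exact ⟨p, hevp p⟩
  have hlocal : IsLocalRing B := IsLocalRing.of_surjective' (ev : PowerSeries A →+* B) hsurj
  have hnoeth : IsNoetherianRing B :=
    isNoetherianRing_of_surjective _ _ (ev : PowerSeries A →+* B) hsurj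
  have hevX : ev PowerSeries.X = α := by
    rw [← Polynomial.coe_X, hevp, aeval_X]
  -- An inverse of α would give X D - 1 = g w, and comparing constant coefficients would make g(0) a
  -- unit.
  have hαu : ¬ IsUnit α := by
    intro hu
    obtain ⟨b, hb⟩ := hu.exists_right_inv
    obtain ⟨D, rfl⟩ := hsurj b
    have : ev (PowerSeries.X * D - 1) = 0 := by rw [map_sub, map_mul, hevX, hb, map_one, sub_self]
    obtain ⟨w, hw⟩ := (hev0 _).1 this
    have h1 := congrArg PowerSeries.constantCoeff hw
    simp only [map_sub, map_mul, PowerSeries.constantCoeff_X, zero_mul, map_one, zero_sub,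
      constantCoeff_coe] at h1
    exact hg0.not_isUnit (.of_mul_eq_one (-PowerSeries.constantCoeff w) (by
      rw [mul_neg, ← h1, neg_neg]))
  have hg0α : α ∣ algebraMap A B (g.coeff 0) := by
    have h1 := hα
    rw [← divX_mul_X_add g, map_add, map_mul, aeval_X, aeval_C] at h1
    exact ⟨-aeval α g.divX, by linear_combination h1⟩
  have hα0 : α ≠ 0 := by
    rintro rfl
    rw [zero_dvd_iff] at hg0α
    exact hg0.ne_zero (FaithfulSMul.algebraMap_injective A B (by rw [hg0α, map_zero]))
  -- Modulo α, the value of D is its constant coefficient. For a nonunit this is a multiple of g(0),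
  -- which α divides because g(α) = 0.
  have hmax : maximalIdeal B = Ideal.span {α} := by
    refine le_antisymm (fun b hb ↦ ?_) ?_
    · obtain ⟨D, rfl⟩ := hsurj b
      have hD : ¬ IsUnit D := fun h ↦ hb (h.map ev)
      rw [PowerSeries.isUnit_iff_constantCoeff, ← mem_nonunits_iff, ← mem_maximalIdeal,
        hg0.maximalIdeal_eq, Ideal.mem_span_singleton] at hD
      obtain ⟨c, hc⟩ := hD
      obtain ⟨D₁, hD₁⟩ := PowerSeries.X_dvd_iff.2 (show
        (D - PowerSeries.C (PowerSeries.constantCoeff D)).constantCoeff = 0 by simp)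
      rw [sub_eq_iff_eq_add] at hD₁
      rw [Ideal.mem_span_singleton, hD₁, map_add, map_mul, hevX, hc, ← PowerSeries.algebraMap_eq,
        AlgHom.commutes, map_mul]
      exact dvd_add (dvd_mul_right _ _) (hg0α.mul_right _)
    · rw [Ideal.span_singleton_le_iff_mem, mem_maximalIdeal]
      exact hαu
  have hfield : ¬ IsField B := by
    rw [isField_iff_maximalIdeal_eq, hmax, Ideal.span_singleton_eq_bot]
    exact hα0
  have hdvr : IsDiscreteValuationRing B :=
    ((IsDiscreteValuationRing.TFAE B hfield).out 0 4).2 (show (maximalIdeal B).IsPrincipal from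
      ⟨⟨α, hmax⟩⟩)
  exact ⟨hdvr, (IsDiscreteValuationRing.irreducible_iff_uniformizer α).2 hmax⟩

/-- The integral closure of `A` in the extension generated by a root of an Eisenstein polynomial is
generated by this root. -/
theorem exists_eq_aeval_of_isIntegral {L E : Type*} [Field L] [Field E] [Algebra A L]
    [IsFractionRing A L] [Algebra A E] [Algebra L E] [IsScalarTower A L E]
    (hd : g.IsDistinguishedAt (maximalIdeal A)) (hg : Irreducible g)
    (hg0 : Irreducible (g.coeff 0)) {α : E} (hα : aeval α g = 0)
    (hgen : ∀ z : E, ∃ p : L[X], z = aeval α p) {z : E} (hz : IsIntegral A z) :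
    ∃ p : A[X], z = aeval α p := by
  have hinj : Function.Injective (algebraMap A E) := by
    rw [IsScalarTower.algebraMap_eq A L E]
    exact (algebraMap L E).injective.comp (IsFractionRing.injective A L)
  have : FaithfulSMul A E := (faithfulSMul_iff_algebraMap_injective A E).2 hinj
  let B := Algebra.adjoin A {α}
  let β : B := ⟨α, Algebra.self_mem_adjoin_singleton A α⟩
  have hβ : ∀ p : A[X], ((aeval β p : B) : E) = aeval α p := fun p ↦ by
    have := Polynomial.aeval_algHom_apply B.val β p
    exact this.symm
  have hB : ∀ b : B, ∃ p : A[X], b = aeval β p := by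
    rintro ⟨b, hb⟩
    have hb' : b ∈ Algebra.adjoin A {α} := hb
    rw [Algebra.adjoin_singleton_eq_range_aeval] at hb'
    obtain ⟨p, hp⟩ := hb'
    exact ⟨p, Subtype.ext (by rw [hβ]; exact hp.symm)⟩
  have : FaithfulSMul A B := (faithfulSMul_iff_algebraMap_injective A B).2 fun a b hab ↦
    hinj (congrArg (Subtype.val : B → E) hab)
  have hdvr := (isDiscreteValuationRing_of_root hd hg hg0 (α := β)
    (Subtype.ext (by rw [hβ, hα]; rfl)) hB).1
  have hfrac : IsFractionRing B E := by
    refine IsFractionRing.of_field B E fun z ↦ ?_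
    obtain ⟨p, rfl⟩ := hgen z
    obtain ⟨b, hbM, hb⟩ := IsLocalization.integerNormalization_spec (nonZeroDivisors A) p
    refine ⟨aeval β (IsLocalization.integerNormalization (nonZeroDivisors A) p),
      algebraMap A B b, ?_⟩
    have h1 : (algebraMap B E) (algebraMap A B b) = algebraMap A E b := rfl
    have h2 : (algebraMap B E) (aeval β
        (IsLocalization.integerNormalization (nonZeroDivisors A) p)) =
        algebraMap A E b * aeval α p := by
      change ((aeval β (IsLocalization.integerNormalization (nonZeroDivisors A) p) : B) : E) = _
      rw [hβ, ← aeval_map_algebraMap L, hb, ← algebraMap_smul L b p, map_smul, Algebra.smul_def,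
        ← IsScalarTower.algebraMap_apply]
    rw [h1, h2, mul_div_cancel_left₀]
    rw [Ne, map_eq_zero_iff _ hinj]
    exact nonZeroDivisors.ne_zero hbM
  -- A[α] is a discrete valuation ring with fraction field E, hence integrally closed, so it already
  -- contains z.
  have hzB : IsIntegral B z := hz.tower_top
  obtain ⟨b, hb⟩ := IsIntegrallyClosed.isIntegral_iff.1 hzB
  obtain ⟨p, rfl⟩ := hB b
  exact ⟨p, by rw [← hb, ← hβ]; rfl⟩

end DVR

/-! ### Completeness of finite free modules -/

section Complete

/-- A finite free module over a complete local noetherian ring is complete. -/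
theorem isAdicComplete_of_finite {O : Type*} [CommRing O] [IsNoetherianRing O] [IsLocalRing O]
    {I : Ideal O} (hI : I ≠ ⊤) [IsAdicComplete I O] (M : Type*) [AddCommGroup M] [Module O M]
    [Module.Finite O M] [Module.Free O M] : IsAdicComplete I M where
  toIsHausdorff := IsHausdorff.of_isLocalRing I M hI
  prec' := by
    intro u hu
    let b := Module.Free.chooseBasis O M
    have hcoord : ∀ i, ∃ l : O, ∀ n, b.coord i (u n) ≡ l [SMOD (I ^ n • ⊤ : Submodule O O)] := by
      intro i
      refine IsPrecomplete.prec' (I := I) (fun n ↦ b.coord i (u n)) fun {m n} hmn ↦ ?_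
      have h1 := hu hmn
      rw [SModEq.sub_mem] at h1 ⊢
      rw [← map_sub]
      have h2 := Submodule.mem_map_of_mem (f := b.coord i) h1
      rw [Submodule.map_smul''] at h2
      exact Submodule.smul_mono le_rfl le_top h2
    choose l hl using hcoord
    refine ⟨∑ i, l i • b i, fun n ↦ ?_⟩
    rw [SModEq.sub_mem]
    rw [← b.sum_repr (u n), ← Finset.sum_sub_distrib]
    refine sum_mem fun i _ ↦ ?_
    rw [← sub_smul]
    refine Submodule.smul_mem_smul ?_ trivial
    have := hl i n
    rwa [SModEq.sub_mem, smul_eq_mul, Ideal.mul_top] at this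

end Complete

/-! ### The integers of the unramified extension -/

section Unramified

variable {O A : Type*} [CommRing O] [IsDomain O] [IsDiscreteValuationRing O]
  [IsAdicComplete (maximalIdeal O) O] [CommRing A] [IsDomain A] [Algebra O A]
  [Module.Finite O A] [FaithfulSMul O A]

/-- A complete domain `A` is local with maximal ideal `J` if it has an automorphism of finite order
that lifts the `q`-th power map of `A ⧸ J`. -/
theorem isMaximal_of_frobenius {A : Type*} [CommRing A] [IsDomain A] (J : Ideal A)
    [IsAdicComplete J A] {q r : ℕ} (hq : 2 ≤ q) (hr : 0 < r) (s : A ≃+* A)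
    (hsr : ∀ a, s^[r] a = a) (hs : ∀ a, s a - a ^ q ∈ J) : J.IsMaximal := by
  have hJ : J ≠ ⊤ := by
    rintro rfl
    have h : IsHausdorff (⊤ : Ideal A) A := inferInstance
    have := h.subsingleton
    exact not_subsingleton A this
  have hiter : ∀ i a, Ideal.Quotient.mk J (s^[i] a) = Ideal.Quotient.mk J a ^ q ^ i := by
    intro i
    induction i with
    | zero => simp
    | succ i ih =>
      intro a
      have h1 : Ideal.Quotient.mk J (s a) = Ideal.Quotient.mk J a ^ q := by
        rw [← map_pow]; exact Ideal.Quotient.eq.2 (hs a)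
      rw [Function.iterate_succ_apply, ih, pow_succ' q, pow_mul, h1]
  obtain ⟨Q, hQ⟩ : ∃ Q, q ^ r = Q + 2 := by
    have := Nat.pow_le_pow_right (by omega : 0 < q) (show 1 ≤ r from hr)
    rw [pow_one] at this
    exact ⟨q ^ r - 2, by omega⟩
  have hpow : ∀ x : A ⧸ J, x ^ (Q + 2) = x := by
    intro x
    obtain ⟨a, rfl⟩ := Ideal.Quotient.mk_surjective x
    rw [← hQ, ← hiter, hsr]
  have : Nontrivial (A ⧸ J) := Ideal.Quotient.nontrivial_iff.2 hJ
  refine Ideal.Quotient.maximal_of_isField J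
    ⟨exists_pair_ne _, mul_comm, fun {x} hx ↦ ⟨x ^ Q, ?_⟩⟩
  obtain ⟨a, rfl⟩ := Ideal.Quotient.mk_surjective x
  set x := Ideal.Quotient.mk J a with hxa
  -- An iterate of s is the identity, so x^(q^r) = x with q^r = Q + 2, and x^(Q+1) is idempotent. In
  -- the domain A its lift can only be 0 or 1.
  have hidem : x ^ (Q + 1) * x ^ (Q + 1) = x ^ (Q + 1) := by
    have : x ^ (Q + 1) * x ^ (Q + 1) = x ^ (Q + 2) * x ^ Q := by ring
    rw [this, hpow]; ring
  have hmonic : (X ^ 2 - X : A[X]).Monic := by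
    refine monic_X_pow_sub ?_
    rw [degree_X]; norm_num
  -- Hensel applies to X² - X: at an idempotent i the derivative 2i - 1 is its own inverse.
  obtain ⟨e, he, hea⟩ := HenselianRing.is_henselian (I := J) (X ^ 2 - X : A[X]) hmonic
    (a ^ (Q + 1)) (by
      rw [← Ideal.Quotient.eq_zero_iff_mem]
      simp only [eval_sub, eval_pow, eval_X, map_sub, map_pow, ← hxa]
      rw [sq, hidem, sub_self]) (by
      simp only [map_sub, derivative_X_pow, derivative_X, eval_sub, eval_mul, eval_pow,
        eval_X, eval_one, map_mul, map_pow, map_one, ← hxa]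
      refine .of_mul_eq_one (2 * x ^ (Q + 1) - 1) ?_
      simp only [Nat.cast_ofNat, eval_ofNat, map_ofNat, Nat.add_one_sub_one, pow_one]
      linear_combination 4 * hidem)
  have he' : e = 1 ∨ e = 0 := by
    rw [IsRoot, eval_sub, eval_pow, eval_X] at he
    rcases mul_eq_zero.1 (show (e - 1) * e = 0 by linear_combination he) with h | h
    · exact .inl (sub_eq_zero.1 h)
    · exact .inr h
  have hex : Ideal.Quotient.mk J e = x ^ (Q + 1) := by
    rw [hxa, ← map_pow]; exact Ideal.Quotient.eq.2 hea
  rcases he' with rfl | rfl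
  · rw [← pow_succ', ← hex, map_one]
  · exfalso
    apply hx
    rw [← hpow x, pow_succ, ← hex, map_zero, zero_mul]

/-- A is finite and torsion-free over O, hence complete for 𝔭A, and the Frobenius forces 𝔭A to be
maximal. So A is a noetherian local domain whose maximal ideal is generated by the uniformizer of O.
-/
theorem isDiscreteValuationRing_of_frobenius {q r : ℕ} (hq : 2 ≤ q) (hr : 0 < r) (s : A ≃+* A)
    (hsr : ∀ a, s^[r] a = a)
    (hs : ∀ a, s a - a ^ q ∈ (maximalIdeal O).map (algebraMap O A)) :
    IsDiscreteValuationRing A ∧ IsAdicComplete ((maximalIdeal O).map (algebraMap O A)) A ∧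
      ((maximalIdeal O).map (algebraMap O A)).IsMaximal := by
  set J := (maximalIdeal O).map (algebraMap O A) with hJ
  have hcomp : IsAdicComplete J A := by
    rw [IsAdicComplete.map_algebraMap_iff]
    have : Module.IsTorsionFree O A := inferInstance
    exact isAdicComplete_of_finite (maximalIdeal.isMaximal O).ne_top A
  have hmax := isMaximal_of_frobenius J hq hr s hsr hs
  have hloc : IsLocalRing A := isLocalRing_of_isAdicComplete_maximal J
  have hJm : maximalIdeal A = J := (eq_maximalIdeal hmax).symm
  obtain ⟨ω, hω⟩ := IsDiscreteValuationRing.exists_irreducible O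
  have hJω : J = Ideal.span {algebraMap O A ω} := by
    rw [hJ, hω.maximalIdeal_eq, Ideal.map_span, Set.image_singleton]
  have hnoeth : IsNoetherianRing A := IsNoetherianRing.of_finite O A
  have hfield : ¬ IsField A := by
    rw [isField_iff_maximalIdeal_eq, hJm, hJω, Ideal.span_singleton_eq_bot]
    rw [map_eq_zero_iff _ (FaithfulSMul.algebraMap_injective O A)]
    exact hω.ne_zero
  refine ⟨((IsDiscreteValuationRing.TFAE A hfield).out 0 4).2
    (show (maximalIdeal A).IsPrincipal from ⟨⟨algebraMap O A ω, hJm.trans hJω⟩⟩), hcomp, hmax⟩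

end Unramified

/-! ### Finiteness and separability of the field of roots of unity -/

section RingOfIntegers

variable {O K Ω : Type*} [CommRing O] [IsDomain O] [IsDiscreteValuationRing O]
    [Finite (ResidueField O)]

theorem two_le_residueCard : 2 ≤ residueCard O := by
  have := Finite.one_lt_card (α := ResidueField O)
  exact this

theorem natCast_residueCard_mem : (residueCard O : O) ∈ maximalIdeal O := by
  rw [← residue_eq_zero_iff, map_natCast]
  have := Fintype.ofFinite (ResidueField O)
  rw [residueCard, Nat.card_eq_fintype_card]
  exact FiniteField.cast_card_eq_zero _

variable [Field K] [Algebra O K] [IsFractionRing O K] [Field Ω] [Algebra K Ω]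

theorem natCast_residueCard_pow_sub_one_ne_zero {n : ℕ} (hn : 0 < n) :
    ((residueCard O ^ n - 1 : ℕ) : K) ≠ 0 := by
  have h1 : 1 ≤ residueCard O ^ n :=
    Nat.one_le_pow _ _ ((two_le_residueCard (O := O)).trans' one_le_two)
  have h2 : ((residueCard O ^ n - 1 : ℕ) : O) ≠ 0 := by
    intro h0
    rw [Nat.cast_sub h1, Nat.cast_one, sub_eq_zero, Nat.cast_pow] at h0
    have h3 : (residueCard O : O) ^ n ∈ maximalIdeal O :=
      Ideal.pow_mem_of_mem _ natCast_residueCard_mem n hn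
    rw [h0] at h3
    exact (Ideal.ne_top_iff_one _).1 (maximalIdeal.isMaximal O).ne_top h3
  rw [← map_natCast (algebraMap O K)]
  rwa [Ne, map_eq_zero_iff _ (IsFractionRing.injective O K)]

/-- The integer q^n - 1 is nonzero in K, so X^(q^n - 1) - 1 is separable. Separability is what makes
the integers of L finite over O. -/
theorem finiteDimensional_and_isSeparable_unramifiedExt {n : ℕ} (hn : 0 < n) :
    FiniteDimensional K (unramifiedExt O K Ω n) ∧
      Algebra.IsSeparable K (unramifiedExt O K Ω n) := by
  have hN := natCast_residueCard_pow_sub_one_ne_zero (O := O) (K := K) hn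
  set N := residueCard O ^ n - 1 with hNdef
  have hN0 : N ≠ 0 := by rintro h; rw [h] at hN; simp at hN
  have hroot : ∀ z : Ω, z ^ N = 1 → aeval z (X ^ N - 1 : K[X]) = 0 := by
    intro z hz; simp [hz]
  have hmonic : (X ^ N - 1 : K[X]).Monic := by
    rw [← C_1]; exact monic_X_pow_sub_C 1 hN0
  have hfin : {z : Ω | z ^ N = 1}.Finite := by
    have hmonic' : (X ^ N - 1 : (Polynomial Ω)).Monic := by
      rw [← C_1]; exact monic_X_pow_sub_C 1 hN0
    refine (rootSet_finite (X ^ N - 1 : (Polynomial Ω)) Ω).subset fun z hz ↦ ?_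
    rw [mem_rootSet]
    exact ⟨hmonic'.ne_zero, by simp [show z ^ N = 1 from hz]⟩
  constructor
  · have : Finite {z : Ω | z ^ N = 1} := hfin
    exact IntermediateField.finiteDimensional_adjoin fun z hz ↦ ⟨_, hmonic, hroot z hz⟩
  · rw [unramifiedExt, IntermediateField.isSeparable_adjoin_iff_isSeparable]
    intro z hz
    exact ((X_pow_sub_one_separable_iff).2 hN).of_dvd (minpoly.dvd K z (hroot z hz))

end RingOfIntegers

/-! ### Independence of i(σ) from the uniformizer -/

section Uniformizer

variable {A B : Type*} [CommRing A] [CommRing B] [IsDomain B] [IsDiscreteValuationRing B]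
  [Algebra A B] {α : B}

/-- The valuation of `σ ϖ - ϖ` does not depend on the uniformizer `ϖ`. -/
theorem emultiplicity_sub_eq (hα : Irreducible α) (hgen : ∀ b : B, ∃ p : A[X], b = aeval α p)
    (σ : B ≃ₐ[A] B) {ϖ : B} (hϖ : Irreducible ϖ) :
    emultiplicity ϖ (σ ϖ - ϖ) = emultiplicity α (σ α - α) := by
  -- For another uniformizer α u with u a unit, applying this to b = u gives σ(α u) - α u = (σ α -
  -- α)(σ u + α v), and the last factor is a unit.
  have hdvd : ∀ b, σ α - α ∣ σ b - b := by
    intro b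
    obtain ⟨p, rfl⟩ := hgen b
    have h1 : σ (aeval α p) = aeval (σ α) p := (Polynomial.aeval_algHom_apply σ.toAlgHom α p).symm
    have := Polynomial.sub_dvd_eval_sub (σ α) α (p.map (algebraMap A B))
    rwa [eval_map_algebraMap, eval_map_algebraMap, ← h1] at this
  have hassoc := IsDiscreteValuationRing.associated_of_irreducible B hα hϖ
  obtain ⟨u, rfl⟩ := hassoc
  obtain ⟨v, hv⟩ := hdvd (u : B)
  have hunit : IsUnit (σ u + α * v) := by
    by_contra h
    have h1 : σ u + α * v ∈ maximalIdeal B := h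
    have h2 : α * v ∈ maximalIdeal B := Ideal.mul_mem_right _ _ hα.not_isUnit
    exact ((Ideal.add_mem_iff_left _ h2).1 h1) (u.isUnit.map σ)
  have h3 : σ (α * u) - α * u = (σ α - α) * (σ u + α * v) := by
    rw [map_mul, mul_add, mul_left_comm, ← hv]; ring
  rw [h3, ← emultiplicity_eq_of_associated_left (associated_mul_unit_left α _ u.isUnit)]
  exact emultiplicity_eq_of_associated_right (associated_mul_unit_left _ _ hunit)

end Uniformizer

/-! ### Differences and derivatives of Lubin–Tate iterates -/

section Different

variable {A B : Type*} [CommRing A] [IsDomain A] [IsDiscreteValuationRing A] [CommRing B]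
  [IsLocalRing B] [Algebra A B] {ω : A}

theorem exists_eq_X_pow_add {h : A[X]} {d : ℕ} (hω : Irreducible ω)
    (hh : h.map (residue A) = X ^ d) : ∃ r : A[X], h = X ^ d + C ω * r := by
  have h1 : C ω ∣ h - X ^ d := by
    rw [C_dvd_iff_dvd_coeff]
    intro i
    rw [← Ideal.mem_span_singleton, ← hω.maximalIdeal_eq, ← residue_eq_zero_iff, ← coeff_map]
    simp [hh]
  obtain ⟨r, hr⟩ := h1
  exact ⟨r, by rw [← hr]; ring⟩

omit [IsDomain A] [IsDiscreteValuationRing A] in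
theorem isUnit_aeval_of_isUnit_coeff_zero {r : A[X]} (hr : IsUnit (r.coeff 0)) {x : B}
    (hx : x ∈ maximalIdeal B) : IsUnit (aeval x r) := by
  by_contra h
  have h1 : aeval x r ∈ maximalIdeal B := h
  rw [← divX_mul_X_add r, map_add, map_mul, aeval_X, aeval_C] at h1
  exact ((Ideal.add_mem_iff_right _ (Ideal.mul_mem_left _ _ hx)).1 h1) (hr.map _)

theorem isUnit_of_irreducible_mul {A : Type*} [CommMonoid A] {a b : A} (hb : Irreducible b)
    (ha : Irreducible a) {c : A} (h : b = a * c) : IsUnit c :=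
  (hb.isUnit_or_isUnit h).resolve_left ha.not_isUnit

/-- A root `γ` of an Eisenstein polynomial of degree `d` satisfies `γ ^ d ∼ ω`. -/
theorem associated_pow_of_aeval_eq_zero (hω : Irreducible ω) {h : A[X]} {d : ℕ} (hd : d ≠ 0)
    (hh : h.map (residue A) = X ^ d) (h0 : Irreducible (h.coeff 0)) {γ : B}
    (hγ : γ ∈ maximalIdeal B) (hroot : aeval γ h = 0) :
    Associated (γ ^ d) (algebraMap A B ω) := by
  obtain ⟨r, rfl⟩ := exists_eq_X_pow_add hω hh
  have hr : IsUnit (r.coeff 0) := by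
    refine isUnit_of_irreducible_mul h0 hω ?_
    simp [coeff_X_pow, hd.symm]
  have hu := isUnit_aeval_of_isUnit_coeff_zero hr hγ
  rw [map_add, map_mul, aeval_X_pow, aeval_C] at hroot
  have : γ ^ d = algebraMap A B ω * (-aeval γ r) := by linear_combination hroot
  rw [this]
  exact associated_mul_unit_left _ _ hu.neg

variable {p k q : ℕ} [Fact p.Prime] [CharP (ResidueField A) p] {f : A[X]}

omit [Fact p.Prime] in
theorem exists_natCast_prime_eq (hω : Irreducible ω) : ∃ c : A, (p : A) = ω * c := by
  have : (p : A) ∈ maximalIdeal A := by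
    rw [← residue_eq_zero_iff, map_natCast, CharP.cast_eq_zero]
  rwa [hω.maximalIdeal_eq, Ideal.mem_span_singleton] at this

/-- A Lubin–Tate polynomial is `X ^ q + ω r` with `r'(0)` a unit. -/
theorem IsLT.exists_eq (hf : IsLT q f) (hq : 2 ≤ q) (hω : Irreducible ω) :
    ∃ r : A[X], f = X ^ q + C ω * r ∧ IsUnit (r.derivative.coeff 0) := by
  obtain ⟨r, hr⟩ := exists_eq_X_pow_add hω hf.map_residue
  refine ⟨r, hr, isUnit_of_irreducible_mul hf.coeff_one hω ?_⟩
  rw [hr, coeff_add, coeff_C_mul, coeff_X_pow, if_neg (by omega), coeff_derivative]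
  simp

omit [Fact p.Prime] in
/-- The derivative of a Lubin–Tate polynomial is associated to a uniformizer of the base at every
nonunit. -/
theorem IsLT.associated_aeval_derivative (hf : IsLT q f) (hqp : q = p ^ k) (hq : 2 ≤ q)
    (hω : Irreducible ω) {x : B} (hx : x ∈ maximalIdeal B) :
    Associated (aeval x (derivative f)) (algebraMap A B ω) := by
  obtain ⟨r, hr, hu⟩ := hf.exists_eq hq hω
  obtain ⟨c, hc⟩ := exists_natCast_prime_eq (A := A) (p := p) hω
  obtain ⟨j, rfl⟩ : ∃ j, k = j + 1 := Nat.exists_eq_succ_of_ne_zero (by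
    rintro rfl
    simp at hqp; omega)
  have hqA : (q : A) = ω * (c * (p : A) ^ j) := by
    rw [hqp, Nat.cast_pow, pow_succ', hc]; ring
  -- Since ω divides q, the derivative of X^q also contains the factor ω; what remains has the unit
  -- r'(0) as constant term.
  have h1 : derivative f = C ω * (C (c * (p : A) ^ j) * X ^ (q - 1) + derivative r) := by
    rw [hr, derivative_add, derivative_X_pow, derivative_C_mul, hqA, C_mul]
    ring
  rw [h1, map_mul, aeval_C]
  refine associated_mul_unit_left _ _ (isUnit_aeval_of_isUnit_coeff_zero ?_ hx)
  rwa [coeff_add, coeff_C_mul, coeff_X_pow, if_neg (by omega), mul_zero, zero_add]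

/-- A Lubin–Tate polynomial multiplies small differences by a uniformizer of the base. -/
theorem IsLT.associated_aeval_sub (hf : IsLT q f) (hqp : q = p ^ k) (hq : 2 ≤ q)
    (hω : Irreducible ω) {x y e : B} (hx : x ∈ maximalIdeal B) (hy : y ∈ maximalIdeal B)
    (he : e ∈ maximalIdeal B) (h : algebraMap A B ω * e ∣ (y - x) ^ (q - 1)) :
    Associated (aeval y f - aeval x f) ((y - x) * algebraMap A B ω) := by
  obtain ⟨r, hr, hu⟩ := hf.exists_eq hq hω
  obtain ⟨c, hc⟩ := exists_natCast_prime_eq (A := A) (p := p) hω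
  obtain ⟨w, hw⟩ := h
  obtain ⟨d, rfl⟩ : ∃ d, y = x + d := ⟨y - x, by ring⟩
  rw [add_sub_cancel_left] at hw ⊢
  have hd : d ∈ maximalIdeal B := (Ideal.add_mem_iff_right _ hx).1 hy
  -- The mixed terms of (x + d)^q carry the factor p x d, and d^(q-1) is a multiple of ω e. With f =
  -- X^q + ω r, the difference is therefore d ω times r'(x) plus a nonunit.
  obtain ⟨S, hS⟩ : ∃ S, (x + d) ^ q = x ^ q + d ^ q + p * x * d * S := by
    rw [hqp]; exact ⟨_, add_pow_prime_pow_eq Fact.out x d k⟩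
  obtain ⟨v, hv⟩ : ∃ v, aeval (x + d) r = aeval x r + aeval x (derivative r) * d + v * d ^ 2 := by
    obtain ⟨v, hv⟩ := (r.map (algebraMap A B)).binomExpansion x d
    refine ⟨v, ?_⟩
    rwa [derivative_map, eval_map_algebraMap, eval_map_algebraMap, eval_map_algebraMap] at hv
  have hdq : d ^ q = d * d ^ (q - 1) := by rw [← pow_succ', Nat.sub_add_cancel (by omega)]
  have hpB : (p : B) = algebraMap A B ω * algebraMap A B c := by
    rw [← map_mul, ← hc, map_natCast]
  have hunit : IsUnit (aeval x (derivative r) +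
      (e * w + algebraMap A B c * x * S + v * d)) := by
    by_contra hn
    have h1 : aeval x (derivative r) + (e * w + algebraMap A B c * x * S + v * d) ∈
      maximalIdeal B := hn
    have h2 : e * w + algebraMap A B c * x * S + v * d ∈ maximalIdeal B :=
      add_mem (add_mem (Ideal.mul_mem_right _ _ he)
        (Ideal.mul_mem_right _ _ (Ideal.mul_mem_left _ _ hx))) (Ideal.mul_mem_left _ _ hd)
    exact ((Ideal.add_mem_iff_left _ h2).1 h1) (isUnit_aeval_of_isUnit_coeff_zero hu hx)
  have hexp : aeval (x + d) f - aeval x f = d * algebraMap A B ω *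
      (aeval x (derivative r) + (e * w + algebraMap A B c * x * S + v * d)) := by
    rw [hr]
    simp only [map_add, map_mul, aeval_C, map_pow, aeval_X]
    rw [hS, hv, hdq, hw, hpB]
    ring
  rw [hexp]
  exact associated_mul_unit_left _ _ hunit

variable {s : A ≃+* A}

theorem levelPoly_aeval_mem (hf : IsLT q f) (m : ℕ) {x : B} (hx : x ∈ maximalIdeal B) :
    aeval x (levelPoly s f m) ∈ maximalIdeal B := by
  rw [← divX_mul_X_add (levelPoly s f m), levelPoly_coeff_zero hf, C_0, add_zero, map_mul, aeval_X]
  exact Ideal.mul_mem_left _ _ hx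

omit [Fact p.Prime] in
theorem associated_aeval_derivative_levelPoly (hf : IsLT q f) (hqp : q = p ^ k) (hq : 2 ≤ q)
    (hω : Irreducible ω) (m : ℕ) {x : B} (hx : x ∈ maximalIdeal B) :
    Associated (aeval x (derivative (levelPoly s f m))) (algebraMap A B ω ^ m) := by
  induction m with
  | zero => simp [levelPoly]
  | succ m ih =>
    rw [levelPoly, derivative_comp, map_mul, aeval_comp, pow_succ]
    exact ih.mul_mul ((hf.iterate_map s m).associated_aeval_derivative hqp hq hω
      (levelPoly_aeval_mem hf m hx))

theorem associated_aeval_levelPoly_sub (hf : IsLT q f) (hqp : q = p ^ k) (hq : 2 ≤ q)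
    (hω : Irreducible ω) (m : ℕ) {x y e : B} (hx : x ∈ maximalIdeal B) (hy : y ∈ maximalIdeal B)
    (he : e ∈ maximalIdeal B) (h : algebraMap A B ω * e ∣ (y - x) ^ (q - 1)) :
    Associated (aeval y (levelPoly s f m) - aeval x (levelPoly s f m))
      ((y - x) * algebraMap A B ω ^ m) := by
  induction m with
  | zero => simp [levelPoly]
  | succ m ih =>
    rw [levelPoly, aeval_comp, aeval_comp, pow_succ, ← mul_assoc]
    refine ((hf.iterate_map s m).associated_aeval_sub hqp hq hω (levelPoly_aeval_mem hf m hx)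
      (levelPoly_aeval_mem hf m hy) he ?_).trans (ih.mul_right _)
    -- The difference after m steps is still a multiple of y - x, so the smallness hypothesis
    -- persists.
    refine h.trans (pow_dvd_pow_of_dvd ?_ _)
    exact (dvd_mul_right _ _).trans ih.symm.dvd

end Different

/-! ### The bound on i(τ) and the sum of its values -/

section Sum

variable {A B : Type*} [CommRing A] [IsDomain A] [IsDiscreteValuationRing A] [CommRing B]
  [IsDomain B] [IsDiscreteValuationRing B] [Algebra A B] [FaithfulSMul A B]
  {p k q : ℕ} [Fact p.Prime] [CharP (ResidueField A) p] {f : A[X]} {s : A ≃+* A} {α : B}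

omit [FaithfulSMul A B] in
-- The Eisenstein equation of α computes the ramification index: v(ω) = q^m (q - 1), to which all
-- later valuations are compared.
theorem associated_pow_of_primPoly (hq : 2 ≤ q) (hf : IsLT q f) (m : ℕ) (hα : Irreducible α)
    (hroot : aeval α (primPoly s f m) = 0) {ω : A} (hω : Irreducible ω) :
    Associated (α ^ (q ^ m * (q - 1))) (algebraMap A B ω) := by
  refine associated_pow_of_aeval_eq_zero hω ?_ (primPoly_map_residue (by omega) hf m)
    (primPoly_coeff_zero_irreducible hf m) hα.not_isUnit hroot
  have : 0 < q - 1 := by omega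
  positivity

/-- Distinct roots of `levelPoly s f (m + 1)` are not too close to each other. -/
theorem emultiplicity_sub_le (hqp : q = p ^ k) (hq : 2 ≤ q) (hf : IsLT q f) (m : ℕ)
    (hα : Irreducible α) (hroot : aeval α (primPoly s f m) = 0) {β : B}
    (hβ : aeval β (levelPoly s f (m + 1)) = 0) (hβm : β ∈ maximalIdeal B) (hne : β ≠ α) :
    emultiplicity α (β - α) ≤ q ^ m := by
  obtain ⟨ω, hω⟩ := IsDiscreteValuationRing.exists_irreducible A
  have hassoc := associated_pow_of_primPoly hq hf m hα hroot hω
  by_contra! hlt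
  have hdvd : α ^ (q ^ m + 1) ∣ β - α := by
    apply pow_dvd_of_le_emultiplicity
    rw [← Nat.cast_pow] at hlt
    exact_mod_cast Order.add_one_le_of_lt hlt
  -- The threshold q^m comes from v(ω α) = q^m (q - 1) + 1 ≤ (q^m + 1)(q - 1), valid because q ≥ 2.
  have h1 : algebraMap A B ω * α ∣ (β - α) ^ (q - 1) := by
    refine ((hassoc.mul_right α).symm.dvd).trans ?_
    refine dvd_trans ?_ (pow_dvd_pow_of_dvd hdvd (q - 1))
    rw [← pow_succ, ← pow_mul]
    refine pow_dvd_pow _ ?_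
    rw [add_mul, one_mul]
    omega
  have h2 := associated_aeval_levelPoly_sub (s := s) hf hqp hq hω (m + 1) (x := α) (y := β)
    hα.not_isUnit hβm hα.not_isUnit h1
  have h3 : aeval α (levelPoly s f (m + 1)) = 0 := by
    rw [levelPoly_succ hf, map_mul, hroot, mul_zero]
  rw [hβ, h3, sub_self] at h2
  have h4 := (associated_zero_iff_eq_zero _).1 h2.symm
  rcases mul_eq_zero.1 h4 with h5 | h5
  · exact hne (sub_eq_zero.1 h5)
  · have h6 := eq_zero_of_pow_eq_zero h5
    rw [map_eq_zero_iff _ (FaithfulSMul.algebraMap_injective A B)] at h6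
    exact hω.ne_zero h6

omit [FaithfulSMul A B] [Fact p.Prime] in
/-- The valuation of the different of the extension generated by a primitive root. -/
theorem emultiplicity_derivative (hqp : q = p ^ k) (hq : 2 ≤ q) (hf : IsLT q f) (m : ℕ)
    (hα : Irreducible α) (hroot : aeval α (primPoly s f m) = 0) :
    emultiplicity α (aeval α (derivative (primPoly s f m))) + (q ^ m : ℕ) =
      ((m + 1) * (q ^ m * (q - 1)) : ℕ) := by
  obtain ⟨ω, hω⟩ := IsDiscreteValuationRing.exists_irreducible A
  have hassoc := associated_pow_of_primPoly hq hf m hα hroot hω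
  have hpos : 0 < q - 1 := by omega
  set γ := aeval α (levelPoly s f m) with hγ
  have hγm : γ ∈ maximalIdeal B := levelPoly_aeval_mem hf m hα.not_isUnit
  have hγroot : aeval γ ((Polynomial.map (s : A →+* A))^[m] f).divX = 0 := by
    rw [hγ, ← aeval_comp]; exact hroot
  have hfm := hf.iterate_map s m
  have hγω : Associated (γ ^ (q - 1)) (algebraMap A B ω) :=
    associated_pow_of_aeval_eq_zero hω hpos.ne' (hfm.map_divX (by omega))
      (by rw [coeff_zero_divX]; exact hfm.coeff_one) hγm hγroot
  have hαp := hα.prime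
  have hvpow : ∀ j : ℕ, emultiplicity α (α ^ j) = j := fun j ↦
    emultiplicity_pow_self_of_prime hαp j
  -- γ = f_m(α) is a root of an Eisenstein polynomial of degree q - 1, so (q - 1) v(γ) = v(ω) = q^m
  -- (q - 1).
  have hγα : Associated γ (α ^ q ^ m) := by
    have h1 : Associated (γ ^ (q - 1)) ((α ^ q ^ m) ^ (q - 1)) := by
      rw [← pow_mul]; exact hγω.trans hassoc.symm
    have hγ0 : γ ≠ 0 := by
      intro h0
      rw [h0, zero_pow hpos.ne'] at h1
      have := (associated_zero_iff_eq_zero _).1 h1.symm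
      exact hα.ne_zero (eq_zero_of_pow_eq_zero (eq_zero_of_pow_eq_zero this))
    obtain ⟨j, hj⟩ := IsDiscreteValuationRing.associated_pow_irreducible hγ0 hα
    have h2 := (hj.pow_pow (n := q - 1)).symm.trans h1
    rw [← pow_mul, ← pow_mul] at h2
    have h3 := emultiplicity_eq_of_associated_right (a := α) h2
    rw [hvpow, hvpow] at h3
    have h4 : j * (q - 1) = q ^ m * (q - 1) := by exact_mod_cast h3
    rwa [Nat.eq_of_mul_eq_mul_right hpos h4] at hj
  have hder := associated_aeval_derivative_levelPoly (s := s) hf hqp hq hω (m + 1)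
    (x := α) hα.not_isUnit
  rw [levelPoly_succ hf, derivative_mul, map_add, map_mul, hroot, mul_zero, zero_add, map_mul,
    ← hγ] at hder
  have h5 : Associated (α ^ q ^ m * aeval α (derivative (primPoly s f m)))
      (α ^ ((m + 1) * (q ^ m * (q - 1)))) := by
    refine ((hγα.symm.mul_right _).trans hder).trans ?_
    rw [mul_comm (m + 1), pow_mul]
    exact hassoc.symm.pow_pow
  have h6 := emultiplicity_eq_of_associated_right (a := α) h5
  rw [emultiplicity_mul hαp, hvpow, hvpow] at h6
  rw [← h6, add_comm]

/-- The values of `i` on the nontrivial elements of the Galois group: each is at most `q ^ m`, and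
their sum is the valuation of the different. -/
theorem emultiplicity_le_and_sum (hqp : q = p ^ k) (hq : 2 ≤ q) (hf : IsLT q f) (m : ℕ)
    (hα : Irreducible α) (hroot : aeval α (primPoly s f m) = 0) {G : Type*} [Fintype G]
    [DecidableEq G] (act : G → B ≃ₐ[A] B) (e : G) (he : act e α = α)
    (hinj : Function.Injective fun τ ↦ act τ α) (hcard : Fintype.card G = q ^ m * (q - 1)) :
    (∀ τ, τ ≠ e → emultiplicity α (act τ α - α) ≤ (q ^ m : ℕ)) ∧
    ∑ τ ∈ Finset.univ.erase e, emultiplicity α (act τ α - α) + (q ^ m : ℕ) =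
      ((m + 1) * (q ^ m * (q - 1)) : ℕ) := by
  have hact : ∀ τ (P : A[X]), aeval (act τ α) P = act τ (aeval α P) := fun τ P ↦
    Polynomial.aeval_algHom_apply (act τ).toAlgHom α P
  refine ⟨fun τ hτ ↦ ?_, ?_⟩
  · rw [Nat.cast_pow]
    refine emultiplicity_sub_le hqp hq hf m hα hroot ?_ ?_ ?_
    · rw [hact, levelPoly_succ hf, map_mul, hroot, mul_zero, map_zero]
    · rw [mem_maximalIdeal, mem_nonunits_iff, MulEquiv.isUnit_map]
      exact hα.not_isUnit
    · intro h
      exact hτ (hinj (h.trans he.symm))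
  · have hmonic := primPoly_monic (s := s) (by omega : 1 ≤ q) hf m
    have hprod := eq_prod_X_sub_C_of_injective (hmonic.map (algebraMap A B))
      (by rw [hcard, hmonic.natDegree_map, primPoly_natDegree (by omega) hf]) hinj (fun τ ↦ by
        rw [eval_map_algebraMap, hact, hroot, map_zero])
    rw [← Finset.mul_prod_erase _ _ (Finset.mem_univ e), he] at hprod
    -- The conjugates of α are all the roots of the primitive factor, so its derivative at α is the
    -- product of the differences α - τ α.
    have hder : aeval α (derivative (primPoly s f m)) =
        ∏ τ ∈ Finset.univ.erase e, (α - act τ α) := by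
      rw [← eval_map_algebraMap, ← derivative_map, hprod, derivative_mul, derivative_X_sub_C,
        eval_add, eval_mul, eval_mul, eval_sub, eval_X, eval_C, sub_self, zero_mul, add_zero,
        eval_one, one_mul, eval_prod]
      simp
    rw [← emultiplicity_derivative hqp hq hf m hα hroot, hder,
      Finset.emultiplicity_prod hα.prime]
    congr 1
    refine Finset.sum_congr rfl fun τ _ ↦ ?_
    rw [← emultiplicity_neg, neg_sub]

end Sum

/-! ### The splitting field is generated by one primitive root -/

section SplittingField

variable {A : Type*} [CommRing A] [IsDomain A] [IsDiscreteValuationRing A]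
  [IsAdicComplete (maximalIdeal A) A] {p k q : ℕ} [Fact p.Prime]
  [CharP (ResidueField A) p] {f : A[X]} {s : A ≃+* A} {L Ω : Type*} [Field L] [Field Ω]
  [Algebra A L] [IsFractionRing A L] [Algebra L Ω] [Algebra A Ω] [IsScalarTower A L Ω]
  [IsAlgClosed Ω]

open IntermediateField in
/-- The splitting field of `levelPoly s f (m + 1)` is a Galois extension generated by any primitive
root. -/
theorem exists_adjoin_rootSet_eq (hq : q = p ^ k) (hq2 : 2 ≤ q) (hf : IsLT q f)
    (hs : IsFrobeniusLift q s) (m : ℕ) {ϖ : A} (hϖ : Irreducible ϖ) {ι : Type*} [Fintype ι]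
    (hι : Fintype.card ι = q ^ (m + 1)) (c : ι → A) (hcs : ∀ i, s (c i) = c i)
    (hc : ∀ i j, ϖ ^ (m + 1) ∣ c i - c j → i = j) :
    ∃ α : Ω, aeval α (primPoly s f m) = 0 ∧
      adjoin L (((levelPoly s f (m + 1)).map (algebraMap A L)).rootSet Ω) = L⟮α⟯ ∧
      IsGalois L (adjoin L (((levelPoly s f (m + 1)).map (algebraMap A L)).rootSet Ω)) ∧
      Module.finrank L L⟮α⟯ = q ^ m * (q - 1) := by
  have hinj : Function.Injective (algebraMap A Ω) := by
    rw [IsScalarTower.algebraMap_eq A L Ω]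
    exact (algebraMap L Ω).injective.comp (IsFractionRing.injective A L)
  have : FaithfulSMul A Ω := (faithfulSMul_iff_algebraMap_injective A Ω).2 hinj
  have hmonic := primPoly_monic (s := s) (by omega : 1 ≤ q) hf m
  have hdeg := primPoly_natDegree (s := s) (by omega : 1 ≤ q) hf m
  have hpos : 0 < q ^ m * (q - 1) := by
    have : 0 < q - 1 := by omega
    positivity
  obtain ⟨α, hα⟩ := IsAlgClosed.exists_root ((primPoly s f m).map (algebraMap A Ω)) (by
    rw [degree_eq_natDegree (hmonic.map _).ne_zero, hmonic.natDegree_map, hdeg]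
    exact_mod_cast hpos.ne')
  rw [IsRoot, eval_map_algebraMap] at hα
  obtain ⟨ρ, hρinj, hρroot⟩ := exists_injective_roots hq hq2 hf hs m hα hϖ c hcs hc
  set P := (levelPoly s f (m + 1)).map (algebraMap A L) with hP
  have hPmonic : P.Monic := (levelPoly_monic (by omega) hf (m + 1)).map _
  -- There are as many distinct roots, all polynomials in α, as the degree of P. This gives both
  -- separability and splitting over L(α).
  have hPΩ : P.map (algebraMap L Ω) = ∏ i, (X - C (aeval α (ρ i))) := by
    refine eq_prod_X_sub_C_of_injective (hPmonic.map _) ?_ hρinj fun i ↦ ?_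
    · rw [hι, hPmonic.natDegree_map, hP, (levelPoly_monic (by omega) hf (m + 1)).natDegree_map,
        levelPoly_natDegree (by omega) hf]
    · rw [eval_map_algebraMap, hP, aeval_map_algebraMap, hρroot]
  have hsep : P.Separable := by
    rw [← separable_map (algebraMap L Ω), hPΩ, separable_prod_X_sub_C_iff]
    exact hρinj
  have hirr : Irreducible ((primPoly s f m).map (algebraMap A L)) :=
    (hmonic.irreducible_iff_irreducible_map_fraction_map).1 (primPoly_irreducible hq2 hf m)
  have hminpoly : minpoly L α = (primPoly s f m).map (algebraMap A L) :=
    (minpoly.eq_of_irreducible_of_monic hirr (by rw [aeval_map_algebraMap, hα])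
      (hmonic.map _)).symm
  refine ⟨α, hα, ?_, ?_, ?_⟩
  · refine le_antisymm (adjoin_le_iff.2 fun z hz ↦ ?_) (adjoin_le_iff.2 ?_)
    · rw [mem_rootSet, ← eval_map_algebraMap, hPΩ, eval_prod, Finset.prod_eq_zero_iff] at hz
      obtain ⟨-, i, -, hi⟩ := hz
      rw [eval_sub, eval_X, eval_C, sub_eq_zero] at hi
      rw [hi, ← aeval_map_algebraMap L]
      exact algebra_adjoin_le_adjoin L {α} (aeval_mem_adjoin_singleton L α)
    · rintro z rfl
      refine subset_adjoin _ _ ?_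
      rw [mem_rootSet]
      refine ⟨hPmonic.ne_zero, ?_⟩
      rw [hP, aeval_map_algebraMap, levelPoly_succ hf, map_mul, hα, mul_zero]
  · have := adjoin_rootSet_isSplittingField (IsAlgClosed.splits (P.map (algebraMap L Ω)))
    exact IsGalois.of_separable_splitting_field hsep
  · have hint : IsIntegral L α := ⟨(primPoly s f m).map (algebraMap A L), hmonic.map _, by
      rw [← aeval_def, aeval_map_algebraMap, hα]⟩
    rw [adjoin.finrank hint, hminpoly, hmonic.natDegree_map, hdeg]

end SplittingField

/-! ### The Herbrand function -/

section Herbrand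

variable {G : Type*} [Fintype G] [DecidableEq G]

/-- Evaluation of the Herbrand sum from the values of `i`. -/
theorem herbrand_sum_eq_iff {i : G → ℕ∞} {e : G} (he : i e = ⊤) {q Q m : ℕ} (hq : 2 ≤ q)
    (hQ : 0 < Q) (hi : ∀ τ, τ ≠ e → i τ ≤ (Q : ℕ))
    (hsum : ∑ τ ∈ Finset.univ.erase e, i τ + (Q : ℕ) = ((m + 1) * (Q * (q - 1)) : ℕ)) (t : ℝ≥0) :
    -1 + (∑ τ, (min ((i τ : ℕ∞) : ℝ≥0∞) ((t + 1 : ℝ≥0) : ℝ≥0∞)).toReal) /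
      ((Q * (q - 1) : ℕ) : ℝ) = (((m + 1 : ℕ) : ℝ≥0) : ℝ) ↔ t + 1 = ((Q * q : ℕ) : ℝ≥0) := by
  set S : ℝ≥0 → ℝ := fun u ↦ ∑ τ, (min ((i τ : ℕ∞) : ℝ≥0∞) (u : ℝ≥0∞)).toReal with hS
  have hSe : ∀ u, S u = u + ∑ τ ∈ Finset.univ.erase e,
      (min ((i τ : ℕ∞) : ℝ≥0∞) (u : ℝ≥0∞)).toReal := by
    intro u
    rw [hS]
    dsimp only
    rw [← Finset.add_sum_erase _ _ (Finset.mem_univ e), he]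
    simp
  -- The term of the identity is u itself, so S is strictly increasing; it is enough to find one
  -- point with the desired value.
  have hmono : StrictMono S := by
    intro u v huv
    rw [hSe, hSe]
    refine add_lt_add_of_lt_of_le (by exact_mod_cast huv) (Finset.sum_le_sum fun τ _ ↦ ?_)
    refine ENNReal.toReal_mono (ne_top_of_le_ne_top ENNReal.coe_ne_top (min_le_right _ _)) ?_
    exact min_le_min_left _ (by exact_mod_cast huv.le)
  have hpos : 0 < Q * (q - 1) := Nat.mul_pos hQ (by omega)
  -- At u = Q q every minimum with τ ≠ e is i(τ), since i(τ) ≤ Q. The sum is Q q + (m + 1) Q (q - 1)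
  -- - Q = (m + 2) Q (q - 1).
  have hvalue : S ((Q * q : ℕ) : ℝ≥0) = ((m + 2) * (Q * (q - 1)) : ℕ) := by
    rw [hSe]
    have hnat : ∀ τ ∈ Finset.univ.erase e, i τ = ((i τ).toNat : ℕ) := by
      intro τ hτ
      rw [ENat.natCast_toNat]
      exact ne_top_of_le_ne_top (ENat.natCast_ne_top Q) (hi τ (Finset.ne_of_mem_erase hτ))
    have hterm : ∀ τ ∈ Finset.univ.erase e, (min ((i τ : ℕ∞) : ℝ≥0∞)
        ((((Q * q : ℕ) : ℝ≥0)) : ℝ≥0∞)).toReal = ((i τ).toNat : ℝ) := by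
      intro τ hτ
      have h1 := hi τ (Finset.ne_of_mem_erase hτ)
      have h2 := hnat τ hτ
      rw [h2] at h1 ⊢
      have h3 : (i τ).toNat ≤ Q * q :=
        (Nat.cast_le.1 h1).trans (Nat.le_mul_of_pos_right _ (by omega))
      have h4 : (((i τ).toNat : ℕ∞) : ℝ≥0∞) = (((i τ).toNat : ℕ) : ℝ≥0∞) := by simp
      rw [h4, min_eq_left (by exact_mod_cast h3)]
      simp
    rw [Finset.sum_congr rfl hterm]
    rw [Finset.sum_congr rfl hnat] at hsum
    have hsum' : ∑ τ ∈ Finset.univ.erase e, (i τ).toNat + Q = (m + 1) * (Q * (q - 1)) := by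
      exact_mod_cast hsum
    obtain ⟨r, rfl⟩ : ∃ r, q = r + 1 := ⟨q - 1, by omega⟩
    rw [Nat.add_sub_cancel] at hsum' ⊢
    have : (Q * (r + 1)) + ∑ τ ∈ Finset.univ.erase e, (i τ).toNat = (m + 2) * (Q * r) := by
      linear_combination hsum'
    exact_mod_cast this
  have hN : ((Q * (q - 1) : ℕ) : ℝ) ≠ 0 := by exact_mod_cast hpos.ne'
  have hcast : ((((m + 1 : ℕ) : ℝ≥0)) : ℝ) = (m : ℝ) + 1 := by push_cast; ring
  rw [hcast, ← hmono.injective.eq_iff, hvalue, Nat.cast_mul (m + 2)]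
  change -1 + S (t + 1) / _ = _ ↔ _
  rw [show (-1 + S (t + 1) / ((Q * (q - 1) : ℕ) : ℝ) = (m : ℝ) + 1) ↔
    S (t + 1) / ((Q * (q - 1) : ℕ) : ℝ) = ((m + 2 : ℕ) : ℝ) by
      push_cast; constructor <;> intro h <;> linarith, div_eq_iff hN]

end Herbrand

/-! ### Congruences in O -/

section Congruence

variable {O A : Type*} [CommRing O] [IsDomain O] [IsDiscreteValuationRing O] [CommRing A]
  [IsDomain A] [Algebra O A]

/-- Since ω stays irreducible in A, elements of O that are incongruent modulo ω^m remain incongruent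
in A. -/
theorem pow_dvd_of_algebraMap_pow_dvd {ω : O} (hω : Irreducible ω)
    (hωA : Irreducible (algebraMap O A ω)) {m : ℕ} {a : O}
    (h : algebraMap O A ω ^ m ∣ algebraMap O A a) : ω ^ m ∣ a := by
  rcases eq_or_ne a 0 with rfl | ha
  · exact dvd_zero _
  obtain ⟨j, hj⟩ := IsDiscreteValuationRing.associated_pow_irreducible ha hω
  have h1 : algebraMap O A ω ^ m ∣ algebraMap O A ω ^ j := by
    rw [← map_pow _ _ j]
    exact h.trans (map_dvd _ hj.dvd)
  have h2 := (pow_dvd_pow_iff hωA.ne_zero hωA.not_isUnit).1 h1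
  exact (pow_dvd_pow ω h2).trans hj.symm.dvd

theorem card_quotient_maximalIdeal_pow (O : Type*) [CommRing O] [IsDomain O]
    [IsDiscreteValuationRing O] (m : ℕ) :
    Nat.card (O ⧸ maximalIdeal O ^ m) = residueCard O ^ m := by
  have := cardQuot_pow_of_prime (P := maximalIdeal O)
    (IsDiscreteValuationRing.not_a_field O) (i := m)
  rwa [Submodule.cardQuot_apply, Submodule.cardQuot_apply] at this

end Congruence

/-! ### Comparison of `iterate` with `levelPoly` -/

section Frozen

variable {O K L : Type*} [CommRing O] [IsDomain O] [IsDiscreteValuationRing O]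
  [Field K] [Field L] [Algebra O K] [Algebra O L] [Algebra K L] [IsScalarTower O K L]

omit [IsDomain O] [IsDiscreteValuationRing O] in
theorem coe_iterate_onIntegers (φ : L ≃ₐ[K] L) (i : ℕ) (a : integers O L) :
    (((onIntegers (O := O) φ).toRingEquiv)^[i] a : integers O L) =
      onIntegers (O := O) (φ ^ i) a := by
  induction i with
  | zero => rfl
  | succ i ih =>
    rw [Function.iterate_succ_apply', ih, pow_succ']
    rfl

omit [IsDomain O] [IsDiscreteValuationRing O] in
theorem iterate_map_onIntegers (φ : L ≃ₐ[K] L) (f : (integers O L)[X]) (i : ℕ) :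
    (Polynomial.map ((onIntegers (O := O) φ).toRingEquiv : integers O L →+* integers O L))^[i] f =
      f.map (onIntegers (O := O) (φ ^ i) : integers O L →+* integers O L) := by
  ext1 j
  have : ∀ i, ((Polynomial.map
      ((onIntegers (O := O) φ).toRingEquiv : integers O L →+* integers O L))^[i] f).coeff j =
      ((onIntegers (O := O) φ).toRingEquiv)^[i] (f.coeff j) := by
    intro i
    induction i with
    | zero => rfl
    | succ i ih => rw [Function.iterate_succ_apply', Function.iterate_succ_apply', coeff_map, ih]; rfl
  rw [this, coeff_map, coe_iterate_onIntegers]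
  rfl

omit [IsDomain O] [IsDiscreteValuationRing O] in
theorem iterate_eq_levelPoly (φ : L ≃ₐ[K] L) (f : (integers O L)[X]) (m : ℕ) :
    iterate φ f m = levelPoly (onIntegers (O := O) φ).toRingEquiv f m := by
  induction m with
  | zero => rfl
  | succ m ih => rw [iterate, levelPoly, ih, iterate_map_onIntegers]

end Frozen

/-! ### Total ramification and the upper numbering -/

section Ramification

variable {O L E : Type*} [CommRing O] [IsDomain O] [IsDiscreteValuationRing O]
  [Field L] [Field E] [Algebra O L] [Algebra O E] [Algebra L E] [IsScalarTower O L E]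
  [IsDiscreteValuationRing (integers O L)]
  [IsAdicComplete (maximalIdeal (integers O L)) (integers O L)]
  [IsFractionRing (integers O L) L] {p k q : ℕ} [Fact p.Prime]
  [CharP (ResidueField (integers O L)) p] {f : (integers O L)[X]}
  {s : integers O L ≃+* integers O L}

omit [IsDomain O] [IsDiscreteValuationRing O] in
/-- The extension generated by a primitive root is totally ramified and Galois, and its upper
ramification group at `m + 1` is trivial. -/
theorem isTotallyRamifiedGalois_and_upper_eq (hq : q = p ^ k) (hq2 : 2 ≤ q) (hf : IsLT q f)
    (m : ℕ) [FiniteDimensional L E] [IsGalois L E] {α : E} (hα : aeval α (primPoly s f m) = 0)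
    (hgen : ∀ z : E, ∃ P : L[X], z = aeval α P)
    (hrank : Module.finrank L E = q ^ m * (q - 1)) :
    IsTotallyRamifiedGalois O L E ∧ ∀ ϖ : integers O E, IsUniformizer ϖ →
      upperRamificationGroup L ϖ ((m + 1 : ℕ) : ℝ≥0) = {1} := by
  classical
  let ι : integers O L →ₐ[O] integers O E := (IsScalarTower.toAlgHom O L E).mapIntegralClosure
  let _ : Algebra (integers O L) (integers O E) := ι.toRingHom.toAlgebra
  have : IsScalarTower (integers O L) (integers O E) E := .of_algebraMap_eq fun _ ↦ rfl
  have hinj : Function.Injective (algebraMap (integers O L) (integers O E)) := fun a b hab ↦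
    Subtype.ext ((algebraMap L E).injective (congrArg Subtype.val hab))
  have : FaithfulSMul (integers O L) (integers O E) :=
    (faithfulSMul_iff_algebraMap_injective _ _).2 hinj
  have : Module.IsTorsionFree (integers O L) (integers O E) :=
    Module.isTorsionFree_iff_algebraMap_injective.2 hinj
  have hd := primPoly_isDistinguishedAt (s := s) (by omega : 1 ≤ q) hf m
  have hirr := primPoly_irreducible (s := s) hq2 hf m
  have hirr0 := primPoly_coeff_zero_irreducible (s := s) hf m
  have hintA : IsIntegral (integers O L) α := ⟨primPoly s f m, hd.monic, hα⟩
  have hintO : IsIntegral O α := isIntegral_trans α hintA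
  let β : integers O E := ⟨α, hintO⟩
  have hval : ∀ P : (integers O L)[X], ((aeval β P : integers O E) : E) = aeval α P := fun P ↦
    (aeval_algebraMap_apply E β P).symm
  have hβ : aeval β (primPoly s f m) = 0 := Subtype.ext (by rw [hval, hα]; rfl)
  have hgenB : ∀ b : integers O E, ∃ P : (integers O L)[X], b = aeval β P := by
    intro b
    have hb : IsIntegral (integers O L) (b : E) := IsIntegral.tower_top (R := O) b.2
    obtain ⟨P, hP⟩ := exists_eq_aeval_of_isIntegral hd hirr hirr0 hα hgen hb
    exact ⟨P, Subtype.ext (by rw [hval, hP])⟩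
  obtain ⟨hdvr, hβirr⟩ := isDiscreteValuationRing_of_root hd hirr hirr0 hβ hgenB
  refine ⟨⟨inferInstance, inferInstance, hdvr, fun a ↦ ?_⟩, fun ϖ hϖ ↦ ?_⟩
  · obtain ⟨P, rfl⟩ := hgenB a
    refine ⟨P.coeff 0, fun hu ↦ hβirr.not_isUnit ?_⟩
    -- Every integer is a polynomial in the uniformizer β, hence congruent to its constant term: the
    -- residue field does not grow.
    have h1 : aeval β P - ι (P.coeff 0) = aeval β P.divX * β := by
      conv_lhs => rw [← divX_mul_X_add P, map_add, map_mul, aeval_X, aeval_C]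
      simp only [coeff_add, mul_coeff_zero, coeff_X_zero, mul_zero, coeff_C_zero, zero_add]
      exact add_sub_cancel_right _ _
    rw [h1] at hu
    exact isUnit_of_mul_isUnit_right hu
  · let act : (E ≃ₐ[L] E) → integers O E ≃ₐ[integers O L] integers O E := fun τ ↦
      AlgEquiv.ofRingEquiv (f := ((τ.restrictScalars O).mapIntegralClosure).toRingEquiv)
        fun a ↦ Subtype.ext (τ.commutes _)
    have hact : ∀ τ b, ((act τ b : integers O E) : E) = τ b := fun τ b ↦ rfl
    have hactinj : Function.Injective fun τ ↦ act τ β := by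
      intro τ τ' h
      have h1 : τ α = τ' α := congrArg (Subtype.val : integers O E → E) h
      ext z
      obtain ⟨P, rfl⟩ := hgen z
      have h2 : ∀ τ : E ≃ₐ[L] E, τ (aeval α P) = aeval (τ α) P := fun τ ↦
        (Polynomial.aeval_algHom_apply τ.toAlgHom α P).symm
      rw [h2, h2, h1]
    have hcard : Nat.card (E ≃ₐ[L] E) = q ^ m * (q - 1) := by
      rw [IsGalois.card_aut_eq_finrank, hrank]
    have hram : ∀ τ : E ≃ₐ[L] E, ramIndex ϖ τ = emultiplicity β (act τ β - β) := fun τ ↦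
      emultiplicity_sub_eq hβirr hgenB (act τ) hϖ
    obtain ⟨hle, hsum⟩ := emultiplicity_le_and_sum hq hq2 hf m hβirr hβ act 1 rfl hactinj
      (by rw [← Nat.card_eq_fintype_card, hcard])
    have hone : ramIndex ϖ (1 : E ≃ₐ[L] E) = ⊤ := by
      rw [ramIndex]
      have : ((AlgEquiv.restrictScalars O (1 : E ≃ₐ[L] E)).mapIntegralClosure ϖ) - ϖ = 0 :=
        sub_eq_zero.2 (Subtype.ext rfl)
      rw [this, emultiplicity_zero]
    simp only [← hram] at hle hsum
    have hherb : ∀ t : ℝ≥0, herbrand L ϖ t = (((m + 1 : ℕ) : ℝ≥0) : ℝ) ↔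
        t + 1 = ((q ^ m * q : ℕ) : ℝ≥0) := by
      intro t
      rw [← herbrand_sum_eq_iff hone hq2 (Q := q ^ m) (by positivity) hle hsum t, herbrand, hcard]
    have hQ : 1 ≤ q ^ m * q := Nat.mul_pos (by positivity) (by omega)
    ext σ
    rw [Set.mem_singleton_iff]
    constructor
    · rintro ⟨t, ht, hσ⟩
      by_contra hne
      have h1 := hle σ hne
      have h2 : ((t + 1 : ℝ≥0) : ℝ≥0∞) ≤ ((ramIndex ϖ σ : ℕ∞) : ℝ≥0∞) := hσ
      rw [(hherb t).1 ht] at h2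
      have h3 : ((ramIndex ϖ σ : ℕ∞) : ℝ≥0∞) ≤ ((q ^ m : ℕ) : ℝ≥0∞) := by
        rw [← ENat.toENNReal_coe]
        exact ENat.toENNReal_le.2 h1
      have h4 := h2.trans h3
      have h5 : q ^ m * q ≤ q ^ m := by
        rw [ENNReal.coe_natCast] at h4
        exact Nat.cast_le.1 h4
      have h6 : 0 < q ^ m := by positivity
      nlinarith
    · rintro rfl
      -- The unique t with φ_G(t) = m + 1 is q^(m+1) - 1.
      refine ⟨((q ^ m * q - 1 : ℕ) : ℝ≥0), (hherb _).2 ?_, ?_⟩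
      · rw [← Nat.cast_add_one, Nat.sub_add_cancel hQ]
      · change _ ≤ ((ramIndex ϖ (1 : E ≃ₐ[L] E) : ℕ∞) : ℝ≥0∞)
        rw [hone]
        simp

end Ramification

end LubinTate

/-! ### The theorem -/

open LubinTate in
theorem mainTheorem11
    {O K Ω : Type*} [CommRing O] [IsDomain O] [IsDiscreteValuationRing O]
    [IsAdicComplete (IsLocalRing.maximalIdeal O) O] [Finite (IsLocalRing.ResidueField O)]
    [Field K] [Algebra O K] [IsFractionRing O K]
    [Field Ω] [Algebra K Ω] [IsAlgClosure K Ω] [Algebra O Ω] [IsScalarTower O K Ω]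
    (n : ℕ) (hn : 0 < n) (x : Kˣ) (hx : HasValuation O (x : K) n)
    (L : IntermediateField K Ω) (hL : L = unramifiedExt O K Ω n)
    (φ : L ≃ₐ[K] L) (hφ : IsArithFrobenius O φ)
    (π : integers O L) (hπ : IsUniformizer π) (hN : Algebra.norm K (π : L) = x)
    (f : Polynomial (integers O L)) (hf : IsLubinTatePolynomial π f)
    (m : ℕ) (hm : 1 ≤ m) :
    IsTotallyRamifiedGalois O L (lubinTateExt Ω φ f m) ∧
    ∀ ϖ : integers O (lubinTateExt Ω φ f m), IsUniformizer ϖ →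
      upperRamificationGroup L ϖ (m : NNReal) = {1} := by
  classical
  -- Level m + 1 corresponds to the primitive factor f_{m+1} / f_m, of index m.
  obtain ⟨m, rfl⟩ : ∃ j, m = j + 1 := ⟨m - 1, by omega⟩
  obtain ⟨hfd, hsep⟩ : FiniteDimensional K L ∧ Algebra.IsSeparable K L := by
    rw [hL]; exact finiteDimensional_and_isSeparable_unramifiedExt hn
  have : IsAlgClosed Ω := IsAlgClosure.isAlgClosed K
  have : IsFractionRing (integers O L) L :=
    integralClosure.isFractionRing_of_finite_extension K L
  have : Module.Finite O (integers O L) := IsIntegralClosure.finite O K L (integers O L)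
  have hinj : Function.Injective (algebraMap O (integers O L)) := by
    have h1 : Function.Injective (algebraMap O L) := by
      rw [IsScalarTower.algebraMap_eq O K L]
      exact (algebraMap K L).injective.comp (IsFractionRing.injective O K)
    exact fun a b hab ↦ h1 (congrArg Subtype.val hab)
  have : FaithfulSMul O (integers O L) := (faithfulSMul_iff_algebraMap_injective _ _).2 hinj
  have hq2 : 2 ≤ residueCard O := two_le_residueCard
  set s : integers O L ≃+* integers O L := (onIntegers (O := O) φ).toRingEquiv with hs
  have hsO : ∀ a : O, s (algebraMap O _ a) = algebraMap O _ a := fun a ↦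
    (onIntegers (O := O) φ).commutes a
  have hsr : ∀ a, s^[orderOf φ] a = a := by
    intro a
    rw [hs, coe_iterate_onIntegers, pow_orderOf_eq_one]
    rfl
  obtain ⟨hdvr, hcomp, hmax⟩ := isDiscreteValuationRing_of_frobenius (O := O) hq2
    (orderOf_pos φ) s hsr hφ
  have hmaxeq : (maximalIdeal O).map (algebraMap O (integers O L)) =
      maximalIdeal (integers O L) := eq_maximalIdeal hmax
  rw [hmaxeq] at hcomp
  obtain ⟨p, hp⟩ := CharP.exists (ResidueField O)
  have := Fintype.ofFinite (ResidueField O)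
  obtain ⟨k, hpp, hqp⟩ := FiniteField.card (ResidueField O) p
  have : Fact p.Prime := ⟨hpp⟩
  rw [← Nat.card_eq_fintype_card] at hqp
  have hcharP : CharP (ResidueField (integers O L)) p := by
    rw [CharP.charP_iff_prime_eq_zero hpp]
    have h1 : (p : O) ∈ maximalIdeal O := by
      rw [← residue_eq_zero_iff, map_natCast, CharP.cast_eq_zero]
    have h2 := Ideal.mem_map_of_mem (algebraMap O (integers O L)) h1
    rwa [hmaxeq, map_natCast, ← residue_eq_zero_iff, map_natCast] at h2
  have hfLT : IsLT (residueCard O) f := by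
    refine ⟨hf.monic, hf.coeff_zero, by rw [hf.coeff_one]; exact hπ, ?_⟩
    ext i
    have h1 := hf.congr_pow i
    rw [hmaxeq, ← residue_eq_zero_iff, coeff_sub, map_sub, sub_eq_zero] at h1
    rw [coeff_map, h1, ← coeff_map]
    simp
  have hsF : IsFrobeniusLift (residueCard O) s := by
    intro a
    have h1 := hφ a
    rw [hmaxeq, ← residue_eq_zero_iff, map_sub, sub_eq_zero, map_pow] at h1
    exact h1
  obtain ⟨ω, hω⟩ := IsDiscreteValuationRing.exists_irreducible O
  have hωA : Irreducible (algebraMap O (integers O L) ω) := by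
    rw [IsDiscreteValuationRing.irreducible_iff_uniformizer, ← hmaxeq, hω.maximalIdeal_eq,
      Ideal.map_span, Set.image_singleton]
  have hcardι := card_quotient_maximalIdeal_pow O (m + 1)
  have : Finite (O ⧸ maximalIdeal O ^ (m + 1)) :=
    Nat.finite_of_card_ne_zero (by rw [hcardι]; positivity)
  have := Fintype.ofFinite (O ⧸ maximalIdeal O ^ (m + 1))
  -- The q^(m+1) required elements are representatives of O modulo its (m + 1)-st maximal ideal
  -- power; coming from O, they are fixed by Frobenius.
  obtain ⟨α, hα, hadj, hgal, hrank⟩ := exists_adjoin_rootSet_eq (Ω := Ω) (L := L) hqp hq2 hfLT hsF m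
    hωA (ι := O ⧸ maximalIdeal O ^ (m + 1)) (by rw [← Nat.card_eq_fintype_card, hcardι])
    (fun i ↦ algebraMap O _ (Quotient.out i)) (fun i ↦ hsO _) (by
      intro i j hij
      rw [← map_sub] at hij
      have h1 := pow_dvd_of_algebraMap_pow_dvd hω hωA hij
      rw [← Ideal.mem_span_singleton, ← Ideal.span_singleton_pow, ← hω.maximalIdeal_eq,
        ← Ideal.Quotient.eq] at h1
      rw [← Quotient.out_eq i, ← Quotient.out_eq j]
      exact h1)
  rw [← iterate_eq_levelPoly] at hadj hgal
  change lubinTateExt Ω φ f (m + 1) = _ at hadj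
  change IsGalois L (lubinTateExt Ω φ f (m + 1)) at hgal
  have hmem : α ∈ lubinTateExt Ω φ f (m + 1) := by
    rw [hadj]; exact IntermediateField.mem_adjoin_simple_self L α
  have hrank' : Module.finrank L (lubinTateExt Ω φ f (m + 1)) =
      residueCard O ^ m * (residueCard O - 1) := by rw [hadj, hrank]
  let α' : lubinTateExt Ω φ f (m + 1) := ⟨α, hmem⟩
  refine isTotallyRamifiedGalois_and_upper_eq (s := s) (α := α') hqp hq2 hfLT m ?_ ?_ hrank'
  · refine Subtype.ext ?_
    have := Polynomial.aeval_algebraMap_apply Ω α' (primPoly s f m)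
    exact this.symm.trans hα
  · intro z
    have hz : (z : Ω) ∈ IntermediateField.adjoin L {α} := by rw [← hadj]; exact z.2
    have hint : IsAlgebraic L α := Algebra.IsAlgebraic.isAlgebraic α
    rw [← IntermediateField.mem_toSubalgebra,
      IntermediateField.adjoin_simple_toSubalgebra_of_isAlgebraic hint,
      Algebra.adjoin_singleton_eq_range_aeval] at hz
    obtain ⟨P, hP⟩ := hz
    refine ⟨P, Subtype.ext ?_⟩
    have := Polynomial.aeval_algebraMap_apply Ω α' P
    exact hP.symm.trans this
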